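/- Let $\kappa\ge 1$. There is a constant $C>0$ depending only on $\kappa$ with the following property. Let $R\subset\mathbb{R}^3$ be a closed cuboid (in arbitrary position and of arbitrary size) the ratio of whose longest edge to its shortest edge is at most $\kappa$. Let $K$ be a polyhedron cut from $R$ by a plane, i.e. $K$ is the intersection of $R$ with a closed half-space and has nonempty interior, and let $h_K$ be the diameter of $K$. Let $u\in H^1(R)$, with weak gradient $\nabla u$, and let $\mathrm{P}^0_K u=|K|^{-1}\int_K u\,\mathrm{d}\mathbf{x}$ be the $L^2(K)$-projection of $u$ onto the constants. Then for every (two-dimensional) face $F$ of $K$ the trace of $u$ on $F$ exists in $L^2(F)$ and $$\| u-\mathrm{P}^0_K u\|_{L^2(F)}\le C\,h_K^{1/2}\,\|\nabla u\|_{L^2(R)} .$$ Here the trace is the limit in $L^2(F)$ (with respect to surface measure) of the restrictions to $F$ of any smooth functions that converge to $u$ in $H^1(R)$ and whose restrictions converge in $L^2(F)$. In particular $C$ does not depend on $u$, on the size or position of $R$, or on the position of the cutting plane, so the estimate is uniform even when the height of $F$ towards $K$, or $K$ itself, shrinks to zero. -/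

import Mathlib

open MeasureTheory Filter Topology
open scoped ContDiff

namespace CutCuboid

/-- Three-dimensional Euclidean space. -/
abbrev E3 : Type := EuclideanSpace ℝ (Fin 3)

/-- A (nondegenerate) cuboid in arbitrary position: a corner, three orthonormal edge directions,
and three positive edge lengths. -/
structure Cuboid where
  corner : E3
  axes : OrthonormalBasis (Fin 3) ℝ E3
  side : Fin 3 → ℝ
  side_pos : ∀ i, 0 < side i

/-- The closed solid cuboid. -/
def Cuboid.toSet (R : Cuboid) : Set E3 :=
  {x | ∀ i, R.axes.repr (x - R.corner) i ∈ Set.Icc 0 (R.side i)}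

/-- `K` is a (closed) polyhedron cut from the cuboid `R` by a plane `⟪n, x⟫ = c`: the part of `R`
on one side of the plane, of nonempty interior. Both sides occur, through `(-n, -c)`. No lower bound
on the size of `K` is imposed, and the degenerate case `K = R` is allowed. -/
def IsCutFrom (K : Set E3) (R : Cuboid) : Prop :=
  ∃ (n : E3) (c : ℝ), n ≠ 0 ∧ K = R.toSet ∩ {x | inner ℝ n x ≤ c} ∧ (interior K).Nonempty

/-- `F` is a face (facet) of the closed convex polyhedron `K`: a two-dimensional exposed subset,
that is, the set of maximizers over `K` of a linear functional. -/
def IsFace (K F : Set E3) : Prop :=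
  IsExposed ℝ K F ∧ Module.finrank ℝ (vectorSpan ℝ F) = 2

/-- `u ∈ H¹(D)` with weak gradient `∇u = g`, for a closed region `D` whose boundary is null:
`u` and `g` are square integrable and `∫_D u ∇φ = - ∫_D φ g` for every smooth test function `φ`
with compact support in the interior of `D`. -/
structure IsH1 (D : Set E3) (u : E3 → ℝ) (g : E3 → E3) : Prop where
  memLp : MemLp u 2 (volume.restrict D)
  memLp_grad : MemLp g 2 (volume.restrict D)
  weak_grad : ∀ φ : E3 → ℝ, ContDiff ℝ ∞ φ → HasCompactSupport φ → tsupport φ ⊆ interior D →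
    ∫ x in D, u x • gradient φ x = - ∫ x in D, φ x • g x

/-- `γ` is the trace on the planar piece `F ⊆ D` of `u ∈ H¹(D)`, `∇u = g`: it is the limit in
`L²(F)` (for the surface measure) of the restrictions to `F` of smooth functions that converge to
`u` in `H¹(D)`. -/
def IsTrace (D F : Set E3) (u : E3 → ℝ) (g : E3 → E3) (γ : E3 → ℝ) : Prop :=
  MemLp γ 2 (μHE[2].restrict F) ∧
  ∃ φ : ℕ → E3 → ℝ, (∀ k, ContDiff ℝ ∞ (φ k)) ∧
    Tendsto (fun k => eLpNorm (fun x => φ k x - u x) 2 (volume.restrict D)) atTop (𝓝 0) ∧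
    Tendsto (fun k => eLpNorm (fun x => gradient (φ k) x - g x) 2 (volume.restrict D))
      atTop (𝓝 0) ∧
    Tendsto (fun k => eLpNorm (fun x => φ k x - γ x) 2 (μHE[2].restrict F)) atTop (𝓝 0)

/-- The `L²(K)`-orthogonal projection of `u` onto constants, i.e. the mean value of `u` on `K`. -/
noncomputable def proj0 (K : Set E3) (u : E3 → ℝ) : ℝ := ⨍ x in K, u x

end CutCuboid

/-! The estimate is proved for smooth `φ` and then passed to the limit. Enclose `K` in a cuboid `Q ⊆
R` parallel to `R` whose edges are all comparable to `h_K`, with constants depending only on `κ`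
(`Cuboid.exists_enclosing`). A Poincaré inequality on `Q` provides a constant `m` with `∫_Q |φ - m|²
≲ h_K² ∫_Q |∇φ|²` (`exists_lintegral_sub_sq_le`). Let the plane of `F` be a graph over the base of
`Q` orthogonal to the edge most aligned with its normal. On each segment of `Q` in that direction,
`|φ - m|²` is bounded at every point by one quantity (`Cuboid.enorm_sub_sq_le_lineBound`), obtained
by averaging over the full edge of `Q`, never over the possibly tiny section of `K`. Integrated over
the base, this quantity gives `X ≲ κ h_K ∫_Q |∇φ|²`, hence `∫_F |φ - m|² ≤ 3X`.

The delicate point is replacing `m` by the mean of `φ` on `K`, uniformly as `K` degenerates. If `H`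
is the largest height of `K` over the plane, measured along the chosen edge, then `K` lies in a slab
of thickness `2H`, so the pointwise bound gives `∫_K |φ - m|² ≤ 2H X`
(`Cuboid.setLIntegral_slab_sub_sq_le`). By convexity `K` contains the cone over `F` with apex at a
highest point, so `H |S| ≤ 8 |K|`, where `S` is the projection of `F` to the base
(`Cuboid.height_mul_volume_le`). In `|mean - m|² |S| ≤ 2H X |S| / |K|` the height cancels.

For general `u`, contraction towards an interior point followed by mollification gives smooth
approximations in `H¹(R)` (`IsH1.exists_smooth_approx`). A trace bound with a constant allowed to
depend on `R` and `F` makes their restrictions Cauchy in `L²(F)`, and the uniform estimate survives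
the limit. -/

namespace CutCuboid

open scoped ENNReal NNReal Pointwise Convolution
open ContinuousLinearMap (lsmul)

/-! ### Elementary L² inequalities. -/

section Auxiliary

variable {α : Type*} [MeasurableSpace α] {μ : Measure α}

lemma eLpNorm_two_sq {E : Type*} [NormedAddCommGroup E] (f : α → E) (μ : Measure α) :
    eLpNorm f 2 μ ^ 2 = ∫⁻ x, ‖f x‖ₑ ^ 2 ∂μ := by
  have h := eLpNorm_nnreal_pow_eq_lintegral (f := f) (μ := μ) (p := 2) (by norm_num)
  simpa using h

lemma sq_lintegral_le (μ : Measure α) {g : α → ℝ≥0∞} (hg : AEMeasurable g μ) :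
    (∫⁻ x, g x ∂μ) ^ 2 ≤ μ Set.univ * ∫⁻ x, g x ^ 2 ∂μ := by
  have h := ENNReal.lintegral_mul_le_Lp_mul_Lq μ Real.HolderConjugate.two_two
    (f := fun _ => 1) (g := g) aemeasurable_const hg
  simp only [Pi.mul_apply, one_mul, ENNReal.one_rpow, lintegral_const] at h
  calc (∫⁻ x, g x ∂μ) ^ 2 ≤ (μ Set.univ ^ (1 / 2 : ℝ) *
        (∫⁻ x, g x ^ (2 : ℝ) ∂μ) ^ (1 / 2 : ℝ)) ^ 2 := by gcongr
    _ = _ := by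
      rw [mul_pow, ← ENNReal.rpow_natCast, ← ENNReal.rpow_natCast, ← ENNReal.rpow_mul,
        ← ENNReal.rpow_mul]
      norm_num

lemma enorm_add_sq_le {E : Type*} [NormedAddCommGroup E] (a b : E) :
    ‖a + b‖ₑ ^ 2 ≤ 2 * ‖a‖ₑ ^ 2 + 2 * ‖b‖ₑ ^ 2 := by
  calc ‖a + b‖ₑ ^ 2 ≤ (‖a‖ₑ + ‖b‖ₑ) ^ 2 := by gcongr; exact enorm_add_le a b
    _ ≤ 2 * ‖a‖ₑ ^ 2 + 2 * ‖b‖ₑ ^ 2 := by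
      simp only [enorm_eq_nnnorm]
      norm_cast
      rw [← NNReal.coe_le_coe]
      push_cast
      nlinarith [sq_nonneg (‖a‖ - ‖b‖)]

/-- The fundamental theorem of calculus followed by Cauchy–Schwarz; the factor `a` is the length of
the interval. -/
lemma enorm_sub_sq_le_lintegral {f f' : ℝ → ℝ} (hf : ∀ t, HasDerivAt f (f' t) t)
    (hf' : Continuous f') {a s t : ℝ} (hs : s ∈ Set.Icc 0 a) (ht : t ∈ Set.Icc 0 a) :
    ‖f s - f t‖ₑ ^ 2 ≤ ENNReal.ofReal a * ∫⁻ τ in Set.Icc 0 a, ‖f' τ‖ₑ ^ 2 := by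
  wlog hst : t ≤ s generalizing s t
  · rw [enorm_sub_rev]
    exact this ht hs (le_of_not_ge hst)
  have h1 : ‖f s - f t‖ₑ ≤ ∫⁻ τ in Set.Icc 0 a, ‖f' τ‖ₑ := by
    rw [← intervalIntegral.integral_eq_sub_of_hasDerivAt (fun x _ => hf x)
      (hf'.intervalIntegrable t s), intervalIntegral.integral_of_le hst]
    refine (enorm_integral_le_lintegral_enorm _).trans (lintegral_mono_set ?_)
    exact fun x hx => ⟨ht.1.trans hx.1.le, hx.2.trans hs.2⟩
  calc ‖f s - f t‖ₑ ^ 2 ≤ (∫⁻ τ in Set.Icc 0 a, ‖f' τ‖ₑ) ^ 2 := by gcongr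
    _ ≤ _ := by
      refine (sq_lintegral_le _ (by fun_prop)).trans_eq ?_
      simp

end Auxiliary

/-! ### Poincaré inequality on bounded convex sets. -/

section Poincare

lemma lintegral_comp_homothety {G : E3 → ℝ≥0∞} (hG : Measurable G) (x : E3) {s : ℝ}
    (hs : s ≠ 0) :
    ∫⁻ y, G (x + s • (y - x)) = ENNReal.ofReal |(s ^ 3)⁻¹| * ∫⁻ z, G z := by
  rw [lintegral_sub_right_eq_self (fun y => G (x + s • y)) x]
  have h := Measure.map_addHaar_smul (volume : Measure E3) hs
  rw [← lintegral_map (f := fun z => G (x + z)) (g := fun y : E3 => s • y) (by fun_prop)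
    (by fun_prop), h, lintegral_smul_measure, lintegral_add_left_eq_self]
  simp

/-- Convexity keeps the contracted copy of `Q` inside `Q`, and the Jacobian factor `s⁻³` is at most
8 because `s ≥ 1/2`. -/
lemma setLIntegral_comp_homothety_le {G : E3 → ℝ≥0∞} (hG : Measurable G) {Q : Set E3}
    (hQ : Convex ℝ Q) (hQm : MeasurableSet Q) {x : E3} (hx : x ∈ Q) {s : ℝ}
    (hs : s ∈ Set.Icc (1 / 2 : ℝ) 1) :
    ∫⁻ y in Q, G (x + s • (y - x)) ≤ 8 * ∫⁻ z in Q, G z := by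
  have hs0 : 0 < s := by linarith [hs.1]
  calc ∫⁻ y in Q, G (x + s • (y - x)) ≤ ∫⁻ y, Q.indicator G (x + s • (y - x)) := by
        rw [← lintegral_indicator hQm]
        refine lintegral_mono fun y => ?_
        by_cases hy : y ∈ Q
        · rw [Set.indicator_of_mem hy, Set.indicator_of_mem]
          exact hQ.add_smul_sub_mem hx hy ⟨hs0.le, hs.2⟩
        · rw [Set.indicator_of_notMem hy]; exact zero_le
    _ = ENNReal.ofReal |(s ^ 3)⁻¹| * ∫⁻ z in Q, G z := by
        rw [lintegral_comp_homothety (hG.indicator hQm) x hs0.ne', lintegral_indicator hQm]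
    _ ≤ 8 * ∫⁻ z in Q, G z := by
        gcongr
        rw [abs_of_pos (by positivity)]
        refine ENNReal.ofReal_le_of_le_toReal ?_
        simp only [ENNReal.toReal_ofNat]
        rw [inv_le_comm₀ (by positivity) (by norm_num)]
        calc (8 : ℝ)⁻¹ = (1 / 2) ^ 3 := by norm_num
          _ ≤ s ^ 3 := by gcongr; exact hs.1

lemma hasDerivAt_comp_segment {φ : E3 → ℝ} (hφ : ContDiff ℝ 1 φ) (x v : E3) (s : ℝ) :
    HasDerivAt (fun s : ℝ => φ (x + s • v)) (inner ℝ (gradient φ (x + s • v)) v) s := by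
  have h1 : HasFDerivAt φ (fderiv ℝ φ (x + s • v)) (x + s • v) :=
    (hφ.differentiable one_ne_zero _).hasFDerivAt
  have h2 : HasDerivAt (fun s : ℝ => x + s • v) v s := by
    simpa using ((hasDerivAt_id s).smul_const v).const_add x
  have := h1.comp_hasDerivAt s h2
  simpa [gradient, InnerProductSpace.toDual_symm_apply, Function.comp_def] using this

lemma continuous_gradient {φ : E3 → ℝ} (hφ : ContDiff ℝ 1 φ) : Continuous (gradient φ) := by
  unfold gradient
  exact (LinearIsometryEquiv.continuous _).comp (hφ.continuous_fderiv one_ne_zero)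

lemma enorm_sub_sq_le_segment {φ : E3 → ℝ} (hφ : ContDiff ℝ 1 φ) (x y : E3) :
    ‖φ x - φ y‖ₑ ^ 2 ≤ ‖y - x‖ₑ ^ 2 *
      ∫⁻ s in Set.Icc (0 : ℝ) 1, ‖gradient φ (x + s • (y - x))‖ₑ ^ 2 := by
  have hc := continuous_gradient hφ
  have h := enorm_sub_sq_le_lintegral (fun s => hasDerivAt_comp_segment hφ x (y - x) s)
    (by fun_prop) (a := 1) (s := 0) (t := 1) (by simp) (by simp)
  simp only [zero_smul, add_zero, one_smul, add_sub_cancel, ENNReal.ofReal_one, one_mul] at h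
  refine h.trans ?_
  rw [← lintegral_const_mul _ (Continuous.measurable (by fun_prop))]
  refine lintegral_mono fun s => ?_
  rw [← mul_pow, mul_comm]
  gcongr
  simpa only [enorm_eq_nnnorm, ← ENNReal.coe_mul, ENNReal.coe_le_coe]
    using nnnorm_inner_le_nnnorm (𝕜 := ℝ) (gradient φ (x + s • (y - x))) (y - x)

/-- The Jacobian factor `s⁻³` of the homothety centred at `x` blows up at `s = 0`. The half of the
segment near `x` is therefore described from `y` by `s ↦ 1 - s`, so that only parameters in `[1/2,
1]` remain. -/
lemma setLIntegral_segment_le {G : E3 → ℝ≥0∞} (hG : Measurable G) (x y : E3) :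
    ∫⁻ s in Set.Icc (0 : ℝ) 1, G (x + s • (y - x)) ≤
      (∫⁻ s in Set.Icc (1 / 2 : ℝ) 1, G (x + s • (y - x))) +
        ∫⁻ s in Set.Icc (1 / 2 : ℝ) 1, G (y + s • (x - y)) := by
  have hsub : Set.Icc (0 : ℝ) 1 ⊆ Set.Icc (1 / 2 : ℝ) 1 ∪ Set.Icc 0 (1 / 2 : ℝ) := by
    intro s hs
    rcases le_total (1 / 2) s with h | h
    · exact Or.inl ⟨h, hs.2⟩
    · exact Or.inr ⟨hs.1, h⟩
  refine (lintegral_mono_set hsub).trans ((lintegral_union_le _ _ _).trans ?_)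
  refine add_le_add le_rfl ?_
  have hmp : MeasurePreserving (fun s : ℝ => 1 - s) volume volume :=
    Measure.measurePreserving_sub_left volume 1
  have := hmp.setLIntegral_comp_preimage (s := Set.Icc (1 / 2 : ℝ) 1) measurableSet_Icc
    (f := fun s => G (y + s • (x - y))) (by fun_prop)
  rw [← this]
  have hpre : (fun s : ℝ => 1 - s) ⁻¹' Set.Icc (1 / 2 : ℝ) 1 = Set.Icc 0 (1 / 2) := by
    ext s
    simp only [Set.mem_preimage, Set.mem_Icc]
    constructor <;> rintro ⟨h1, h2⟩ <;> constructor <;> linarith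
  rw [hpre]
  exact le_of_eq (lintegral_congr fun s => congrArg G (by module))

lemma measurable_setLIntegral_segment {G : E3 → ℝ≥0∞} (hG : Measurable G) :
    Measurable (fun p : E3 × E3 =>
      ∫⁻ s in Set.Icc (1 / 2 : ℝ) 1, G (p.1 + s • (p.2 - p.1))) := by
  have hGu : Measurable (fun p : (E3 × E3) × ℝ => G (p.1.1 + p.2 • (p.1.2 - p.1.1))) := by
    fun_prop
  exact hGu.lintegral_prod_right'

lemma lintegral_lintegral_segment_le {G : E3 → ℝ≥0∞} (hG : Measurable G) {Q : Set E3}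
    (hQ : Convex ℝ Q) (hQm : MeasurableSet Q) :
    ∫⁻ x in Q, ∫⁻ y in Q, ∫⁻ s in Set.Icc (1 / 2 : ℝ) 1, G (x + s • (y - x)) ≤
      8 * volume Q * ∫⁻ z in Q, G z := by
  have hswap : ∀ x ∈ Q, ∫⁻ y in Q, ∫⁻ s in Set.Icc (1 / 2 : ℝ) 1, G (x + s • (y - x)) ≤
      8 * ∫⁻ z in Q, G z := by
    intro x hx
    rw [lintegral_lintegral_swap (Measurable.aemeasurable (by fun_prop))]
    calc ∫⁻ s in Set.Icc (1 / 2 : ℝ) 1, ∫⁻ y in Q, G (x + s • (y - x))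
        ≤ ∫⁻ s in Set.Icc (1 / 2 : ℝ) 1, 8 * ∫⁻ z in Q, G z :=
          setLIntegral_mono measurable_const
            fun s hs => setLIntegral_comp_homothety_le hG hQ hQm hx hs
      _ ≤ _ := by
          rw [setLIntegral_const, Real.volume_Icc]
          refine mul_le_of_le_one_right' ?_
          rw [← ENNReal.ofReal_one]
          exact ENNReal.ofReal_le_ofReal (by norm_num)
  refine (setLIntegral_mono' hQm hswap).trans_eq ?_
  rw [setLIntegral_const]
  ring

/-- The double-integral form of the Poincaré inequality on a bounded convex set. -/
lemma lintegral_lintegral_sub_sq_le {φ : E3 → ℝ} (hφ : ContDiff ℝ 1 φ) {Q : Set E3}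
    (hQ : Convex ℝ Q) (hQm : MeasurableSet Q) {D : ℝ≥0∞}
    (hD : ∀ x ∈ Q, ∀ y ∈ Q, ‖y - x‖ₑ ^ 2 ≤ D) :
    ∫⁻ x in Q, ∫⁻ y in Q, ‖φ x - φ y‖ₑ ^ 2 ≤
      16 * D * volume Q * ∫⁻ z in Q, ‖gradient φ z‖ₑ ^ 2 := by
  have hc := continuous_gradient hφ
  obtain ⟨G, hGdef⟩ : ∃ G : E3 → ℝ≥0∞, G = fun z => ‖gradient φ z‖ₑ ^ 2 := ⟨_, rfl⟩
  have hG : Measurable G := by rw [hGdef]; exact Continuous.measurable (by fun_prop)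
  obtain ⟨A, hA⟩ : ∃ A : E3 → E3 → ℝ≥0∞,
      ∀ x y, A x y = ∫⁻ s in Set.Icc (1 / 2 : ℝ) 1, G (x + s • (y - x)) := ⟨_, fun _ _ => rfl⟩
  have hAm : Measurable (fun p : E3 × E3 => A p.1 p.2) := by
    simp only [hA]; exact measurable_setLIntegral_segment hG
  have hA1 : ∀ x, Measurable (fun y => A x y) := fun x =>
    hAm.comp (measurable_const.prodMk measurable_id)
  have hpt : ∀ x ∈ Q, ∀ y ∈ Q, ‖φ x - φ y‖ₑ ^ 2 ≤ D * (A x y + A y x) := by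
    intro x hx y hy
    refine (enorm_sub_sq_le_segment hφ x y).trans ?_
    refine mul_le_mul' (hD x hx y hy) ?_
    rw [hA, hA]
    simpa only [hGdef] using setLIntegral_segment_le hG x y
  have hA2 : Measurable (fun p : E3 × E3 => A p.1 p.2 + A p.2 p.1) :=
    hAm.add (hAm.comp measurable_swap)
  have hle : ∫⁻ x in Q, ∫⁻ y in Q, A x y ≤ 8 * volume Q * ∫⁻ z in Q, G z := by
    simp only [hA]; exact lintegral_lintegral_segment_le hG hQ hQm
  calc ∫⁻ x in Q, ∫⁻ y in Q, ‖φ x - φ y‖ₑ ^ 2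
      ≤ ∫⁻ x in Q, ∫⁻ y in Q, D * (A x y + A y x) :=
        setLIntegral_mono' hQm fun x hx => setLIntegral_mono' hQm fun y hy => hpt x hx y hy
    _ = D * ∫⁻ x in Q, ∫⁻ y in Q, (A x y + A y x) := by
        rw [← lintegral_const_mul _ hA2.lintegral_prod_right']
        refine lintegral_congr fun x => ?_
        exact lintegral_const_mul D
          (hA2.comp measurable_prodMk_left : Measurable fun y => A x y + A y x)
    _ = D * ((∫⁻ x in Q, ∫⁻ y in Q, A x y) + ∫⁻ x in Q, ∫⁻ y in Q, A y x) := by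
        rw [← lintegral_add_left hAm.lintegral_prod_right']
        congr 1
        exact lintegral_congr fun x => lintegral_add_left (hA1 x) _
    _ = D * ((∫⁻ x in Q, ∫⁻ y in Q, A x y) + ∫⁻ x in Q, ∫⁻ y in Q, A x y) := by
        rw [lintegral_lintegral_swap (f := fun x y => A y x)
          (hAm.comp measurable_swap).aemeasurable]
    _ ≤ D * (8 * volume Q * (∫⁻ z in Q, G z) + 8 * volume Q * ∫⁻ z in Q, G z) := by
        gcongr
    _ = _ := by rw [hGdef]; ring

/-- Some `x ∈ Q` does no worse than the average in the double integral, and `m = φ x`. Any constant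
serves here, since the mean over `K` is compared with `m` later. -/
lemma exists_lintegral_sub_sq_le {φ : E3 → ℝ} (hφ : ContDiff ℝ 1 φ) {Q : Set E3}
    (hQ : Convex ℝ Q) (hQm : MeasurableSet Q) (hQ0 : volume Q ≠ 0) (hQt : volume Q ≠ ⊤) {D : ℝ≥0∞}
    (hD : ∀ x ∈ Q, ∀ y ∈ Q, ‖y - x‖ₑ ^ 2 ≤ D) :
    ∃ m : ℝ, ∫⁻ x in Q, ‖φ x - m‖ₑ ^ 2 ≤ 16 * D * ∫⁻ z in Q, ‖gradient φ z‖ₑ ^ 2 := by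
  have hφc := hφ.continuous
  have hm : Measurable (fun p : E3 × E3 => ‖φ p.2 - φ p.1‖ₑ ^ 2) := by fun_prop
  obtain ⟨x, -, h⟩ := exists_le_setLAverage hQ0 hQt
    (f := fun y : E3 => ∫⁻ x in Q, ‖φ x - φ y‖ₑ ^ 2)
    (hm.lintegral_prod_right').aemeasurable
  refine ⟨φ x, h.trans ?_⟩
  rw [setLAverage_eq]
  refine ENNReal.div_le_of_le_mul ?_
  rw [lintegral_lintegral_swap hm.aemeasurable]
  refine (lintegral_lintegral_sub_sq_le hφ hQ hQm hD).trans_eq ?_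
  ring

end Poincare

/-! ### Isometric coordinates on a cuboid and Fubini along an edge. -/

section Chart

/-- Coordinates adapted to a cuboid, with the coordinate along the edge direction `i` split off. -/
noncomputable def Cuboid.chart (R : Cuboid) (i : Fin 3) (p : ℝ × (Fin 2 → ℝ)) : E3 :=
  R.corner + R.axes.repr.symm (WithLp.toLp 2 (i.insertNth p.1 p.2))

/-- The base of a cuboid orthogonal to the edge direction `i`. -/
def Cuboid.base (R : Cuboid) (i : Fin 3) : Set (Fin 2 → ℝ) :=
  Set.Icc 0 fun j => R.side (i.succAbove j)

variable (R : Cuboid) (i : Fin 3)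

lemma Cuboid.measurePreserving_chart : MeasurePreserving (R.chart i) := by
  have h1 := (volume_preserving_piFinSuccAbove (fun _ : Fin 3 => ℝ) i).symm
  have h2 := (PiLp.volume_preserving_toLp (Fin 3))
  have h3 := R.axes.repr.symm.measurePreserving
  have h4 := measurePreserving_add_left (volume : Measure E3) R.corner
  exact h4.comp (h3.comp (h2.comp h1))

lemma Cuboid.continuous_chart : Continuous (R.chart i) := by
  unfold Cuboid.chart
  have : Continuous fun p : ℝ × (Fin 2 → ℝ) => (i.insertNth p.1 p.2 : Fin 3 → ℝ) :=
    Continuous.finInsertNth i continuous_fst continuous_snd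
  fun_prop

lemma Cuboid.repr_chart (p : ℝ × (Fin 2 → ℝ)) :
    R.axes.repr (R.chart i p - R.corner) = WithLp.toLp 2 (i.insertNth p.1 p.2) := by
  simp [Cuboid.chart]

lemma Cuboid.chart_repr (x : E3) :
    R.chart i (R.axes.repr (x - R.corner) i,
      fun j => R.axes.repr (x - R.corner) (i.succAbove j)) = x := by
  have h : (i.insertNth (R.axes.repr (x - R.corner) i)
      (fun j => R.axes.repr (x - R.corner) (i.succAbove j)) : Fin 3 → ℝ) =
      fun k => R.axes.repr (x - R.corner) k := by
    rw [Fin.insertNth_eq_iff]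
    exact ⟨rfl, rfl⟩
  simp only [Cuboid.chart, h]
  have : WithLp.toLp 2 (fun k => R.axes.repr (x - R.corner) k) = R.axes.repr (x - R.corner) := rfl
  rw [this, LinearIsometryEquiv.symm_apply_apply, add_sub_cancel]

lemma Cuboid.chart_surjective : Function.Surjective (R.chart i) := fun x => ⟨_, R.chart_repr i x⟩

lemma Cuboid.chart_mem_toSet {p : ℝ × (Fin 2 → ℝ)} :
    R.chart i p ∈ R.toSet ↔ p.1 ∈ Set.Icc 0 (R.side i) ∧ p.2 ∈ R.base i := by
  simp only [Cuboid.toSet, Set.mem_ofPred_eq, R.repr_chart, i.forall_iff_succAbove, Cuboid.base,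
    Set.mem_Icc, Fin.insertNth_apply_same, Fin.insertNth_apply_succAbove, Pi.le_def, Pi.zero_apply,
    forall_and]
  tauto

lemma Cuboid.chart_sub_chart (p q : ℝ × (Fin 2 → ℝ)) :
    R.chart i p - R.chart i q =
      R.axes.repr.symm (WithLp.toLp 2 (i.insertNth (p.1 - q.1) (p.2 - q.2))) := by
  have : (i.insertNth (p.1 - q.1) (p.2 - q.2) : Fin 3 → ℝ) =
      i.insertNth p.1 p.2 - i.insertNth q.1 q.2 := by
    rw [Fin.insertNth_eq_iff]
    constructor
    · simp
    · ext j; simp [Fin.removeNth]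
  rw [this, Cuboid.chart, Cuboid.chart, add_sub_add_left_eq_sub, WithLp.toLp_sub, map_sub]

lemma Cuboid.chart_combo (p q : ℝ × (Fin 2 → ℝ)) (s : ℝ) :
    R.chart i ((1 - s) • p + s • q) = (1 - s) • R.chart i p + s • R.chart i q := by
  have h1 := R.chart_sub_chart i ((1 - s) • p + s • q) p
  have h2 := R.chart_sub_chart i q p
  have h3 : (i.insertNth (((1 - s) • p + s • q).1 - p.1) (((1 - s) • p + s • q).2 - p.2) :
      Fin 3 → ℝ) = s • i.insertNth (q.1 - p.1) (q.2 - p.2) := by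
    rw [Fin.insertNth_eq_iff]
    constructor
    · simp; ring
    · ext j; simp [Fin.removeNth]; ring
  rw [h3, WithLp.toLp_smul, map_smul, ← h2, sub_eq_iff_eq_add] at h1
  rw [h1]
  module

lemma Cuboid.norm_chart_sub_chart_sq (p q : ℝ × (Fin 2 → ℝ)) :
    ‖R.chart i p - R.chart i q‖ ^ 2 = (p.1 - q.1) ^ 2 + ∑ j, (p.2 j - q.2 j) ^ 2 := by
  rw [R.chart_sub_chart, LinearIsometryEquiv.norm_map, EuclideanSpace.norm_sq_eq,
    Fin.sum_univ_succAbove _ i]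
  simp

lemma Cuboid.chart_line (t : ℝ) (y : Fin 2 → ℝ) :
    R.chart i (t, y) = R.chart i (0, y) + t • R.axes i := by
  have h := R.chart_sub_chart i (t, y) (0, y)
  simp only [sub_zero, sub_self] at h
  rw [← sub_eq_iff_eq_add', h]
  have : (i.insertNth t (0 : Fin 2 → ℝ) : Fin 3 → ℝ) = t • Pi.single i 1 := by
    rw [Fin.insertNth_eq_iff]
    constructor
    · simp
    · ext j; simp [Fin.removeNth]
  rw [this, WithLp.toLp_smul, map_smul]
  congr 1
  exact R.axes.repr_symm_single i

lemma Cuboid.lintegral_eq {f : E3 → ℝ≥0∞} (hf : Measurable f) :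
    ∫⁻ x, f x = ∫⁻ y, ∫⁻ t, f (R.chart i (t, y)) := by
  rw [← (R.measurePreserving_chart i).lintegral_comp hf, Measure.volume_eq_prod,
    lintegral_prod_symm (fun p => f (R.chart i p))
      (hf.comp (R.continuous_chart i).measurable).aemeasurable]

lemma Cuboid.isClosed_toSet : IsClosed R.toSet := by
  have : R.toSet = ⋂ j, {x | R.axes.repr (x - R.corner) j ∈ Set.Icc 0 (R.side j)} := by
    ext x; simp [Cuboid.toSet]
  rw [this]
  refine isClosed_iInter fun j => IsClosed.preimage (f := fun x => R.axes.repr (x - R.corner) j)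
    ?_ isClosed_Icc
  have h : Continuous fun x => R.axes.repr (x - R.corner) := by fun_prop
  exact (EuclideanSpace.proj (𝕜 := ℝ) j).continuous.comp h

lemma Cuboid.measurableSet_base : MeasurableSet (R.base i) := measurableSet_Icc

lemma Cuboid.setLIntegral_toSet {f : E3 → ℝ≥0∞} (hf : Measurable f) :
    ∫⁻ x in R.toSet, f x =
      ∫⁻ y in R.base i, ∫⁻ t in Set.Icc 0 (R.side i), f (R.chart i (t, y)) := by
  rw [← lintegral_indicator R.isClosed_toSet.measurableSet,
    R.lintegral_eq i (hf.indicator R.isClosed_toSet.measurableSet),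
    ← lintegral_indicator (R.measurableSet_base i)]
  refine lintegral_congr fun y => ?_
  by_cases hy : y ∈ R.base i
  · rw [Set.indicator_of_mem hy, ← lintegral_indicator measurableSet_Icc]
    refine lintegral_congr fun t => ?_
    by_cases ht : t ∈ Set.Icc 0 (R.side i)
    · rw [Set.indicator_of_mem ht, Set.indicator_of_mem ((R.chart_mem_toSet i).2 ⟨ht, hy⟩)]
    · rw [Set.indicator_of_notMem ht,
        Set.indicator_of_notMem fun h => ht ((R.chart_mem_toSet i).1 h).1]
  · rw [Set.indicator_of_notMem hy]
    refine (lintegral_congr fun t => ?_).trans lintegral_zero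
    exact Set.indicator_of_notMem (fun h => hy ((R.chart_mem_toSet i).1 h).2) _

end Chart

/-! ### A pointwise bound along edge-parallel segments. -/

section Line

variable (R : Cuboid) (i : Fin 3)

/-- The bound for `‖φ - m‖ ^ 2` at any point of the segment of `R` in direction `i` over `y`. -/
noncomputable def Cuboid.lineBound (φ : E3 → ℝ) (m : ℝ) (y : Fin 2 → ℝ) : ℝ≥0∞ :=
  2 / ENNReal.ofReal (R.side i) *
      (∫⁻ t in Set.Icc 0 (R.side i), ‖φ (R.chart i (t, y)) - m‖ₑ ^ 2) +
    2 * ENNReal.ofReal (R.side i) *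
      ∫⁻ t in Set.Icc 0 (R.side i), ‖gradient φ (R.chart i (t, y))‖ₑ ^ 2

/-- The integral of `Cuboid.lineBound` over the base of `R`. -/
noncomputable def Cuboid.sectionBound (φ : E3 → ℝ) (m : ℝ) : ℝ≥0∞ :=
  2 / ENNReal.ofReal (R.side i) * (∫⁻ x in R.toSet, ‖φ x - m‖ₑ ^ 2) +
    2 * ENNReal.ofReal (R.side i) * ∫⁻ x in R.toSet, ‖gradient φ x‖ₑ ^ 2

variable {φ : E3 → ℝ} (hφ : ContDiff ℝ 1 φ) (m : ℝ)
include hφ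

lemma Cuboid.measurable_lineBound : Measurable (R.lineBound i φ m) := by
  have hc := R.continuous_chart i
  have h0 := hφ.continuous
  have h1 := continuous_gradient hφ
  have hc' : Continuous fun p : (Fin 2 → ℝ) × ℝ => R.chart i (p.2, p.1) :=
    hc.comp continuous_swap
  have m1 : Measurable fun p : (Fin 2 → ℝ) × ℝ => ‖φ (R.chart i (p.2, p.1)) - m‖ₑ ^ 2 :=
    Continuous.measurable (by fun_prop)
  have m2 : Measurable fun p : (Fin 2 → ℝ) × ℝ => ‖gradient φ (R.chart i (p.2, p.1))‖ₑ ^ 2 :=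
    Continuous.measurable (by fun_prop)
  exact (m1.lintegral_prod_right'.const_mul _).add (m2.lintegral_prod_right'.const_mul _)

lemma Cuboid.lintegral_lineBound :
    ∫⁻ y in R.base i, R.lineBound i φ m y = R.sectionBound i φ m := by
  have hc := R.continuous_chart i
  have h0 := hφ.continuous
  have h1 := continuous_gradient hφ
  have hc' : Continuous fun p : (Fin 2 → ℝ) × ℝ => R.chart i (p.2, p.1) :=
    hc.comp continuous_swap
  have m1 : Measurable fun p : (Fin 2 → ℝ) × ℝ => ‖φ (R.chart i (p.2, p.1)) - m‖ₑ ^ 2 :=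
    Continuous.measurable (by fun_prop)
  have m2 : Measurable fun p : (Fin 2 → ℝ) × ℝ => ‖gradient φ (R.chart i (p.2, p.1))‖ₑ ^ 2 :=
    Continuous.measurable (by fun_prop)
  unfold Cuboid.lineBound Cuboid.sectionBound
  rw [lintegral_add_left (m1.lintegral_prod_right'.const_mul _),
    lintegral_const_mul _ m1.lintegral_prod_right', lintegral_const_mul _ m2.lintegral_prod_right',
    R.setLIntegral_toSet i (Continuous.measurable (by fun_prop)),
    R.setLIntegral_toSet i (Continuous.measurable (by fun_prop))]

/-- A one-dimensional trace inequality: compare the value at `s` with the value at `t`, then average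
over `t` in the full edge. The bound is the same for all `s`, so it can be integrated over a graph
as well as over a thin slab. -/
lemma Cuboid.enorm_sub_sq_le_lineBound {s : ℝ} (hs : s ∈ Set.Icc 0 (R.side i))
    (y : Fin 2 → ℝ) : ‖φ (R.chart i (s, y)) - m‖ₑ ^ 2 ≤ R.lineBound i φ m y := by
  have hc := R.continuous_chart i
  have h0 := hφ.continuous
  have h1 := continuous_gradient hφ
  set a := ENNReal.ofReal (R.side i) with ha
  have ha0 : a ≠ 0 := by simpa [ha] using R.side_pos i
  have hat : a ≠ ⊤ := ENNReal.ofReal_ne_top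
  set B := ∫⁻ t in Set.Icc 0 (R.side i), ‖gradient φ (R.chart i (t, y))‖ₑ ^ 2 with hB
  have hder : ∀ t, HasDerivAt (fun t => φ (R.chart i (t, y)))
      (inner ℝ (gradient φ (R.chart i (t, y))) (R.axes i)) t := by
    intro t
    have h := hasDerivAt_comp_segment hφ (R.chart i (0, y)) (R.axes i) t
    rw [← R.chart_line] at h
    exact h.congr_of_eventuallyEq (Eventually.of_forall fun t => congrArg φ (R.chart_line i t y))
  have hpt : ∀ t ∈ Set.Icc 0 (R.side i), ‖φ (R.chart i (s, y)) - m‖ₑ ^ 2 ≤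
      2 * ‖φ (R.chart i (t, y)) - m‖ₑ ^ 2 + 2 * (a * B) := by
    intro t ht
    have h2 := enorm_sub_sq_le_lintegral hder (by fun_prop) hs ht
    have h3 : ∫⁻ τ in Set.Icc 0 (R.side i),
        ‖inner ℝ (gradient φ (R.chart i (τ, y))) (R.axes i)‖ₑ ^ 2 ≤ B := by
      refine lintegral_mono fun τ => ?_
      gcongr
      have := norm_inner_le_norm (𝕜 := ℝ) (gradient φ (R.chart i (τ, y))) (R.axes i)
      rw [R.axes.norm_eq_one, mul_one] at this
      exact enorm_le_iff_norm_le.2 this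
    calc ‖φ (R.chart i (s, y)) - m‖ₑ ^ 2
        = ‖(φ (R.chart i (t, y)) - m) + (φ (R.chart i (s, y)) - φ (R.chart i (t, y)))‖ₑ ^ 2 := by
          congr 2; ring
      _ ≤ 2 * ‖φ (R.chart i (t, y)) - m‖ₑ ^ 2 +
          2 * ‖φ (R.chart i (s, y)) - φ (R.chart i (t, y))‖ₑ ^ 2 := enorm_add_sq_le _ _
      _ ≤ _ := by gcongr; exact h2.trans (by gcongr)
  have hint := setLIntegral_mono' (μ := volume) (measurableSet_Icc (a := (0 : ℝ)) (b := R.side i)) hpt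
  rw [setLIntegral_const, lintegral_add_right _ measurable_const, setLIntegral_const,
    lintegral_const_mul _ (Continuous.measurable (by fun_prop)), Real.volume_Icc, sub_zero,
    ← ha] at hint
  rw [← ENNReal.le_div_iff_mul_le (Or.inl ha0) (Or.inl hat)] at hint
  refine hint.trans_eq ?_
  rw [Cuboid.lineBound, ENNReal.add_div, ← ha, ← hB]
  congr 1
  · simp only [ENNReal.div_eq_inv_mul]; ring
  · rw [mul_div_assoc, ENNReal.div_self ha0 hat, mul_one, mul_assoc]

end Line

/-! ### Surface measure under Lipschitz maps. -/

section HausdorffMeasure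

lemma euclideanHausdorffMeasure_image_le {X Y : Type*} [EMetricSpace X] [MeasurableSpace X]
    [BorelSpace X] [EMetricSpace Y] [MeasurableSpace Y] [BorelSpace Y] {K : ℝ≥0} {f : X → Y}
    (hf : LipschitzWith K f) (d : ℕ) (s : Set X) :
    (μHE[d] : Measure Y) (f '' s) ≤ (K : ℝ≥0∞) ^ d * (μHE[d] : Measure X) s := by
  have h := hf.hausdorffMeasure_image_le (d := d) (by positivity) s
  rw [ENNReal.rpow_natCast] at h
  simp only [Measure.euclideanHausdorffMeasure_def, Measure.smul_apply]
  simp only [ENNReal.smul_def, smul_eq_mul]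
  calc _ ≤ _ := mul_le_mul_right h _
    _ = _ := by ring

end HausdorffMeasure

/-! ### The plane of a face as a graph over the base. -/

section Graph

variable (R : Cuboid) (i : Fin 3) (l : E3 →L[ℝ] ℝ) (c : ℝ)

/-- The affine function whose graph over the base of `R` is the plane `l = c`. -/
noncomputable def Cuboid.height (y : Fin 2 → ℝ) : ℝ := (c - l (R.chart i (0, y))) / l (R.axes i)

/-- The parametrization of the plane `l = c` as a graph over the base of `R`. -/
noncomputable def Cuboid.graph (y : Fin 2 → ℝ) : E3 := R.chart i (R.height i l c y, y)

variable {l}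

/-- The edge most aligned with the normal of the plane is chosen; all slopes of the resulting graph
are then at most 1 in absolute value, whatever the position of the plane. -/
lemma exists_axis (hl : l ≠ 0) : ∃ i, l (R.axes i) ≠ 0 ∧ ∀ j, |l (R.axes j)| ≤ |l (R.axes i)| := by
  obtain ⟨i, hi⟩ := Finite.exists_max fun j => |l (R.axes j)|
  refine ⟨i, fun h0 => hl ?_, hi⟩
  have h : ∀ j, l (R.axes j) = 0 := fun j => by simpa [h0] using hi j
  have : (l : E3 →ₗ[ℝ] ℝ) = 0 := R.axes.toBasis.ext fun j => by simpa using h j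
  ext x
  exact congrArg (fun f : E3 →ₗ[ℝ] ℝ => f x) this

variable {i}

lemma Cuboid.apply_chart (hi : l (R.axes i) ≠ 0) (t : ℝ) (y : Fin 2 → ℝ) :
    l (R.chart i (t, y)) = c + l (R.axes i) * (t - R.height i l c y) := by
  rw [R.chart_line i t y, map_add, map_smul, Cuboid.height]
  field_simp
  simp only [smul_eq_mul]
  ring

lemma Cuboid.continuous_height : Continuous (R.height i l c) := by
  have := R.continuous_chart i
  unfold Cuboid.height
  fun_prop

lemma Cuboid.continuous_graph : Continuous (R.graph i l c) := by
  have := R.continuous_chart i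
  have := R.continuous_height (i := i) (l := l) c
  unfold Cuboid.graph
  fun_prop

lemma Cuboid.height_combo (y z : Fin 2 → ℝ) (s : ℝ) :
    R.height i l c ((1 - s) • y + s • z) =
      (1 - s) * R.height i l c y + s * R.height i l c z := by
  have h := R.chart_combo i (0, y) (0, z) s
  have h0 : (1 - s) • ((0 : ℝ), y) + s • ((0 : ℝ), z) = (0, (1 - s) • y + s • z) := by
    ext <;> simp
  rw [h0] at h
  simp only [Cuboid.height, h, map_add, map_smul, smul_eq_mul]
  ring

lemma Cuboid.exists_graph_eq (hi : l (R.axes i) ≠ 0) {x : E3} (hx : l x = c) :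
    ∃ y, R.graph i l c y = x := by
  obtain ⟨⟨t, y⟩, rfl⟩ := R.chart_surjective i x
  refine ⟨y, ?_⟩
  rw [R.apply_chart c hi] at hx
  have : t = R.height i l c y := by
    have := mul_eq_zero.1 (add_eq_left.1 hx)
    exact sub_eq_zero.1 (this.resolve_left hi)
  rw [Cuboid.graph, ← this]

/-- The height is affine with two slopes of modulus at most 1, and `(p + q)² ≤ 2p² + 2q²`. -/
lemma Cuboid.height_sub_sq_le
    (hmax : ∀ j, |l (R.axes j)| ≤ |l (R.axes i)|) (y z : Fin 2 → ℝ) :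
    (R.height i l c y - R.height i l c z) ^ 2 ≤ 2 * ∑ j, (y j - z j) ^ 2 := by
  have h1 : R.chart i (0, z) - R.chart i (0, y) =
      ∑ j, (z j - y j) • R.axes (i.succAbove j) := by
    rw [R.chart_sub_chart, ← R.axes.sum_repr_symm, Fin.sum_univ_succAbove _ i]
    simp
  have h2 : R.height i l c y - R.height i l c z =
      ∑ j, (z j - y j) * (l (R.axes (i.succAbove j)) / l (R.axes i)) := by
    have : R.height i l c y - R.height i l c z =
        l (R.chart i (0, z) - R.chart i (0, y)) / l (R.axes i) := by
      rw [Cuboid.height, Cuboid.height, map_sub]; ring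
    rw [this, h1, map_sum, Finset.sum_div]
    refine Finset.sum_congr rfl fun j _ => ?_
    rw [map_smul, smul_eq_mul, mul_div_assoc]
  have h3 : ∀ j, (l (R.axes (i.succAbove j)) / l (R.axes i)) ^ 2 ≤ 1 := fun j => by
    rw [sq_le_one_iff_abs_le_one, abs_div]
    exact div_le_one_of_le₀ (hmax _) (abs_nonneg _)
  rw [h2]
  simp only [Fin.sum_univ_two]
  set a := l (R.axes (i.succAbove 0)) / l (R.axes i)
  set b := l (R.axes (i.succAbove 1)) / l (R.axes i)
  have ha : a ^ 2 ≤ 1 := h3 0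
  have hb : b ^ 2 ≤ 1 := h3 1
  nlinarith [sq_nonneg ((z 0 - y 0) * a - (z 1 - y 1) * b),
    mul_nonneg (sq_nonneg (z 0 - y 0)) (sub_nonneg.2 ha),
    mul_nonneg (sq_nonneg (z 1 - y 1)) (sub_nonneg.2 hb)]

/-- The constant is `3 = 1 + 2`: the base contributes 1 and the height 2 to the squared distance.
The domain is `EuclideanSpace` because `Fin 2 → ℝ` carries the sup metric. -/
lemma Cuboid.lipschitzWith_graph
    (hmax : ∀ j, |l (R.axes j)| ≤ |l (R.axes i)|) :
    LipschitzWith (NNReal.sqrt 3) fun y : EuclideanSpace ℝ (Fin 2) => R.graph i l c y.ofLp := by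
  refine LipschitzWith.of_dist_le_mul fun y z => ?_
  rw [dist_eq_norm, dist_eq_norm, Real.coe_sqrt]
  refine le_of_sq_le_sq ?_ (by positivity)
  rw [mul_pow, Real.sq_sqrt (by positivity), Cuboid.graph, Cuboid.graph,
    R.norm_chart_sub_chart_sq, EuclideanSpace.norm_sq_eq]
  have := R.height_sub_sq_le c hmax y.ofLp z.ofLp
  simp only [PiLp.sub_apply, Real.norm_eq_abs, sq_abs, NNReal.coe_ofNat]
  linarith

lemma Cuboid.euclideanHausdorffMeasure_graph_image_le
    (hmax : ∀ j, |l (R.axes j)| ≤ |l (R.axes i)|) {S : Set (Fin 2 → ℝ)} (hS : MeasurableSet S) :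
    μHE[2] (R.graph i l c '' S) ≤ 3 * volume S := by
  have h := euclideanHausdorffMeasure_image_le (R.lipschitzWith_graph c hmax) 2
    ((WithLp.ofLp : EuclideanSpace ℝ (Fin 2) → _) ⁻¹' S)
  have h1 : (fun y : EuclideanSpace ℝ (Fin 2) => R.graph i l c y.ofLp) ''
      ((WithLp.ofLp : EuclideanSpace ℝ (Fin 2) → _) ⁻¹' S) = R.graph i l c '' S := by
    ext x
    constructor
    · rintro ⟨y, hy, rfl⟩; exact ⟨y.ofLp, hy, rfl⟩
    · rintro ⟨y, hy, rfl⟩; exact ⟨WithLp.toLp 2 y, hy, rfl⟩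
  rw [h1, EuclideanSpace.euclideanHausdorffMeasure_eq_volume,
    (PiLp.volume_preserving_ofLp (Fin 2)).measure_preimage hS.nullMeasurableSet] at h
  refine h.trans_eq ?_
  congr 1
  rw [← ENNReal.coe_pow, NNReal.sq_sqrt]
  rfl

variable {c}

/-- Surface measure on `F` is dominated by 3 times the pushforward of Lebesgue measure under the
graph map, as every subset of `F` is the image of its preimage. An inequality suffices; no area
formula is needed. -/
lemma Cuboid.setLIntegral_face_le (hi : l (R.axes i) ≠ 0)
    (hmax : ∀ j, |l (R.axes j)| ≤ |l (R.axes i)|) {F : Set E3} (hF : MeasurableSet F)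
    (hFl : ∀ x ∈ F, l x = c) {f : E3 → ℝ≥0∞} (hf : Measurable f) :
    ∫⁻ x in F, f x ∂μHE[2] ≤ 3 * ∫⁻ y in R.graph i l c ⁻¹' F, f (R.graph i l c y) := by
  have hg := (R.continuous_graph (i := i) (l := l) c).measurable
  have hle : (μHE[2] : Measure E3).restrict F ≤
      (3 : ℝ≥0∞) • Measure.map (R.graph i l c) (volume.restrict (R.graph i l c ⁻¹' F)) := by
    refine Measure.le_iff.2 fun B hB => ?_
    rw [Measure.restrict_apply hB, Measure.smul_apply, Measure.map_apply hg hB,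
      Measure.restrict_apply (hg hB), ← Set.preimage_inter, smul_eq_mul]
    have : B ∩ F = R.graph i l c '' (R.graph i l c ⁻¹' (B ∩ F)) := by
      rw [Set.image_preimage_eq_inter_range, eq_comm, Set.inter_eq_left]
      exact fun x hx => R.exists_graph_eq c hi (hFl x hx.2)
    conv_lhs => rw [this]
    exact R.euclideanHausdorffMeasure_graph_image_le c hmax (hg (hB.inter hF))
  refine (lintegral_mono' hle le_rfl).trans_eq ?_
  rw [lintegral_smul_measure, lintegral_map hf hg, smul_eq_mul]

end Graph

/-! ### Face estimate on an enclosing cuboid, uniform in the height of `K`. -/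

section Cut

variable {Q : Cuboid} {i : Fin 3} {l : E3 →L[ℝ] ℝ} {c : ℝ} {K : Set E3}

lemma Cuboid.graph_preimage_subset_base (hKQ : K ⊆ Q.toSet) :
    Q.graph i l c ⁻¹' K ⊆ Q.base i := fun _ hy => ((Q.chart_mem_toSet i).1 (hKQ hy)).2

lemma Cuboid.setLIntegral_face_sub_sq_le {φ : E3 → ℝ} (hφ : ContDiff ℝ 1 φ)
    (hi : l (Q.axes i) ≠ 0) (hmax : ∀ j, |l (Q.axes j)| ≤ |l (Q.axes i)|) {F : Set E3}
    (hF : MeasurableSet F) (hFQ : F ⊆ Q.toSet) (hFl : ∀ x ∈ F, l x = c) (m : ℝ) :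
    ∫⁻ x in F, ‖φ x - m‖ₑ ^ 2 ∂μHE[2] ≤ 3 * Q.sectionBound i φ m := by
  have h0 := hφ.continuous
  have hgm := (Q.continuous_graph (i := i) (l := l) c).measurable
  refine (Q.setLIntegral_face_le hi hmax hF hFl (Continuous.measurable (by fun_prop))).trans ?_
  gcongr
  rw [← Q.lintegral_lineBound i hφ]
  calc ∫⁻ y in Q.graph i l c ⁻¹' F, ‖φ (Q.graph i l c y) - m‖ₑ ^ 2
      ≤ ∫⁻ y in Q.graph i l c ⁻¹' F, Q.lineBound i φ m y := by
        refine setLIntegral_mono' (hgm hF) fun y hy => ?_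
        exact Q.enorm_sub_sq_le_lineBound i hφ m ((Q.chart_mem_toSet i).1 (hFQ hy)).1 y
    _ ≤ _ := lintegral_mono_set (Q.graph_preimage_subset_base hFQ)

/-- Each line in direction `i` meets `K` in a set of length at most `2H`, and on it the integrand is
bounded by a quantity depending on the line only. -/
lemma Cuboid.setLIntegral_slab_sub_sq_le {φ : E3 → ℝ} (hφ : ContDiff ℝ 1 φ)
    (hK : MeasurableSet K) (hKQ : K ⊆ Q.toSet) (m : ℝ) {H : ℝ}
    (hH : ∀ t y, Q.chart i (t, y) ∈ K → |t - Q.height i l c y| ≤ H) :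
    ∫⁻ x in K, ‖φ x - m‖ₑ ^ 2 ≤ ENNReal.ofReal (2 * H) * Q.sectionBound i φ m := by
  have h0 := hφ.continuous
  have hE := Q.measurable_lineBound i hφ m
  have hm : Measurable fun x => ‖φ x - m‖ₑ ^ 2 := Continuous.measurable (by fun_prop)
  rw [← lintegral_indicator hK, Q.lintegral_eq i (hm.indicator hK), ← Q.lintegral_lineBound i hφ,
    ← lintegral_const_mul _ hE, ← lintegral_indicator (Q.measurableSet_base i)]
  refine lintegral_mono fun y => ?_
  by_cases hy : y ∈ Q.base i
  · rw [Set.indicator_of_mem hy]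
    calc _ ≤ ∫⁻ t, (Set.Icc (Q.height i l c y - H) (Q.height i l c y + H)).indicator
          (fun _ => Q.lineBound i φ m y) t := by
          refine lintegral_mono fun t => ?_
          by_cases ht : Q.chart i (t, y) ∈ K
          · have h1 := abs_le.1 (hH t y ht)
            rw [Set.indicator_of_mem ht, Set.indicator_of_mem
              (show t ∈ Set.Icc _ _ from ⟨by linarith [h1.1], by linarith [h1.2]⟩)]
            exact Q.enorm_sub_sq_le_lineBound i hφ m ((Q.chart_mem_toSet i).1 (hKQ ht)).1 y
          · rw [Set.indicator_of_notMem ht]; exact zero_le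
      _ = _ := by
          rw [lintegral_indicator measurableSet_Icc, setLIntegral_const, Real.volume_Icc, mul_comm]
          congr 2
          ring
  · rw [Set.indicator_of_notMem hy, nonpos_iff_eq_zero]
    refine (lintegral_congr fun t => ?_).trans lintegral_zero
    exact Set.indicator_of_notMem (fun h => hy ((Q.chart_mem_toSet i).1 (hKQ h)).2) _

/-- Volume of the cone over the part of `K` in the plane `l = c`, up to a constant. -/
lemma Cuboid.height_mul_volume_le (hKc : Convex ℝ K) (hK : MeasurableSet K)
    {t₀ : ℝ} {y₀ : Fin 2 → ℝ} (h₀ : Q.chart i (t₀, y₀) ∈ K) :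
    ENNReal.ofReal |t₀ - Q.height i l c y₀| * volume (Q.graph i l c ⁻¹' K) ≤ 8 * volume K := by
  set ψ := Q.height i l c with hψ
  have hψc : Continuous ψ := Q.continuous_height c
  set δ := t₀ - ψ y₀ with hδ
  set S := Q.graph i l c ⁻¹' K with hS
  rcases eq_or_ne δ 0 with h0 | h0
  · simp [h0]
  have hch := Q.continuous_chart i
  -- At height `τ = s δ` over the plane, the cone with apex `(t₀, y₀)` has the slice `s y₀ + (1 - s)
  -- S`, of area `(1 - s)² |S| ≥ |S| / 4` for `s ≤ 1/2`. These heights fill an interval of length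
  -- `|δ| / 2`, whence the constant 8. The sign of `δ` is arbitrary.
  have hslice : ∀ τ ∈ Set.uIcc 0 (δ / 2),
      volume S / 4 ≤ volume {y | Q.chart i (τ + ψ y, y) ∈ K} := by
    intro τ hτ
    obtain ⟨s, hs, rfl⟩ : ∃ s ∈ Set.Icc (0 : ℝ) (1 / 2), τ = s * δ := by
      refine ⟨τ / δ, ?_, by field_simp⟩
      rw [Set.mem_uIcc] at hτ
      rcases hτ with hτ | hτ
      · have hδ0 : 0 < δ := lt_of_le_of_ne (by linarith) h0.symm
        exact ⟨div_nonneg hτ.1 hδ0.le, by rw [div_le_iff₀ hδ0]; linarith⟩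
      · have hδ0 : δ < 0 := lt_of_le_of_ne (by linarith) h0
        exact ⟨div_nonneg_of_nonpos hτ.2 hδ0.le, by rw [div_le_iff_of_neg hδ0]; linarith⟩
    have hsub : (fun y => s • y₀ + y) '' ((1 - s) • S) ⊆
        {y | Q.chart i (s * δ + ψ y, y) ∈ K} := by
      rintro _ ⟨_, ⟨y, hy, rfl⟩, rfl⟩
      have hcomb := Q.chart_combo i (ψ y, y) (t₀, y₀) s
      have hmem := hKc hy h₀ (a := 1 - s) (b := s) (by linarith [hs.2]) hs.1 (by ring)
      change Q.chart i (s * δ + ψ (s • y₀ + (1 - s) • y), s • y₀ + (1 - s) • y) ∈ K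
      convert hmem using 1
      rw [Cuboid.graph, ← hcomb]
      congr 1
      ext1
      · rw [add_comm (s • y₀), hψ, Q.height_combo]
        simp [hδ, hψ]; ring
      · simp [add_comm]
    refine le_trans ?_ (measure_mono hsub)
    rw [Set.image_add_left, measure_preimage_add, Measure.addHaar_smul, ENNReal.div_eq_inv_mul]
    gcongr
    rw [Module.finrank_fin_fun, abs_of_nonneg (by positivity)]
    calc (4 : ℝ≥0∞)⁻¹ = ENNReal.ofReal (1 / 4) := by
          rw [one_div, ENNReal.ofReal_inv_of_pos (by norm_num)]; norm_num
      _ ≤ _ := ENNReal.ofReal_le_ofReal (by nlinarith [hs.1, hs.2])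
  -- The shear `t = τ + ψ y` preserves volume and turns slices parallel to the plane into slices `τ
  -- = const`.
  have hvol : volume K = ∫⁻ τ, volume {y | Q.chart i (τ + ψ y, y) ∈ K} := by
    have hone : Measurable (K.indicator (1 : E3 → ℝ≥0∞)) := measurable_one.indicator hK
    have hcont : Continuous fun p : (Fin 2 → ℝ) × ℝ => Q.chart i (p.2 + ψ p.1, p.1) := by fun_prop
    calc volume K = ∫⁻ x, K.indicator 1 x := (lintegral_indicator_one hK).symm
      _ = ∫⁻ y, ∫⁻ t, K.indicator 1 (Q.chart i (t, y)) := Q.lintegral_eq i hone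
      _ = ∫⁻ y, ∫⁻ τ, K.indicator 1 (Q.chart i (τ + ψ y, y)) := by
          refine lintegral_congr fun y => ?_
          exact (lintegral_add_right_eq_self (fun t => K.indicator 1 (Q.chart i (t, y))) (ψ y)).symm
      _ = ∫⁻ τ, ∫⁻ y, K.indicator 1 (Q.chart i (τ + ψ y, y)) :=
          lintegral_lintegral_swap (hone.comp hcont.measurable).aemeasurable
      _ = _ := by
          refine lintegral_congr fun τ => ?_
          have hmeas : MeasurableSet {y | Q.chart i (τ + ψ y, y) ∈ K} := by
            have : Continuous fun y => Q.chart i (τ + ψ y, y) := by fun_prop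
            exact this.measurable hK
          rw [← lintegral_indicator_one hmeas]
          rfl
  have h1 : volume S / 4 * ENNReal.ofReal |δ / 2| ≤ volume K := by
    rw [hvol, ← sub_zero (δ / 2), ← Real.volume_interval, ← setLIntegral_const]
    exact (setLIntegral_mono' measurableSet_uIcc hslice).trans (setLIntegral_le_lintegral _ _)
  have h2 : ENNReal.ofReal |δ| = 2 * ENNReal.ofReal |δ / 2| := by
    rw [abs_div, ENNReal.ofReal_div_of_pos (by norm_num)]
    simp only [Nat.abs_ofNat, ENNReal.ofReal_ofNat]
    rw [ENNReal.mul_div_cancel (by norm_num) (by norm_num)]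
  have h3 : volume S = 4 * (volume S / 4) := by
    rw [ENNReal.mul_div_cancel (by norm_num) (by norm_num)]
  calc ENNReal.ofReal |δ| * volume S = 8 * (volume S / 4 * ENNReal.ofReal |δ / 2|) := by
        rw [h2]; conv_lhs => rw [h3]
        ring
    _ ≤ _ := by gcongr

/-- Cauchy–Schwarz, since `|K| (proj0 K f - m) = ∫_K (f - m)`. -/
lemma enorm_proj0_sub_sq_mul_le {f : E3 → ℝ} (hf : IntegrableOn f K) (hK0 : volume K ≠ 0)
    (hKt : volume K ≠ ⊤) (m : ℝ) :
    ‖proj0 K f - m‖ₑ ^ 2 * volume K ≤ ∫⁻ x in K, ‖f x - m‖ₑ ^ 2 := by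
  have hr : volume.real K ≠ 0 := ENNReal.toReal_ne_zero.2 ⟨hK0, hKt⟩
  have h1 : (volume.real K) * (proj0 K f - m) = ∫ x in K, (f x - m) := by
    rw [integral_sub hf (integrableOn_const hKt), setIntegral_const, proj0, setAverage_eq,
      smul_eq_mul, smul_eq_mul]
    field_simp
  have h2 : volume K * ‖proj0 K f - m‖ₑ ≤ ∫⁻ x in K, ‖f x - m‖ₑ := by
    refine le_trans (le_of_eq ?_) (enorm_integral_le_lintegral_enorm _)
    rw [← h1, enorm_mul]
    congr 1
    rw [Real.enorm_of_nonneg measureReal_nonneg, ofReal_measureReal hKt]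
  have h3 := sq_lintegral_le (volume.restrict K) (g := fun x => ‖f x - m‖ₑ)
    (hf.aestronglyMeasurable.sub aestronglyMeasurable_const).enorm
  rw [Measure.restrict_apply_univ] at h3
  have h4 : volume K * (‖proj0 K f - m‖ₑ ^ 2 * volume K) ≤
      volume K * ∫⁻ x in K, ‖f x - m‖ₑ ^ 2 := by
    calc _ = (volume K * ‖proj0 K f - m‖ₑ) ^ 2 := by ring
      _ ≤ (∫⁻ x in K, ‖f x - m‖ₑ) ^ 2 := by gcongr
      _ ≤ _ := h3
  exact (ENNReal.mul_le_mul_iff_right hK0 hKt).1 h4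

/-- The face estimate for a smooth function in terms of its deviation from a constant on an
enclosing cuboid. -/
lemma Cuboid.setLIntegral_face_sub_proj0_sq_le {φ : E3 → ℝ} (hφ : ContDiff ℝ 1 φ)
    (hi : l (Q.axes i) ≠ 0) (hmax : ∀ j, |l (Q.axes j)| ≤ |l (Q.axes i)|)
    (hKc : Convex ℝ K) (hK : IsCompact K) (hK0 : volume K ≠ 0) (hKQ : K ⊆ Q.toSet)
    {F : Set E3} (hF : F = {x ∈ K | l x = c}) (m : ℝ) :
    ∫⁻ x in F, ‖φ x - proj0 K φ‖ₑ ^ 2 ∂μHE[2] ≤ 102 * Q.sectionBound i φ m := by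
  have h0 := hφ.continuous
  have hKm := hK.isClosed.measurableSet
  have hKt : volume K ≠ ⊤ := hK.measure_lt_top.ne
  have hFc : IsClosed F := by
    rw [hF]
    exact hK.isClosed.inter (isClosed_eq l.continuous continuous_const)
  have hFm := hFc.measurableSet
  have hFK : F ⊆ K := by rw [hF]; exact fun x hx => hx.1
  have hFl : ∀ x ∈ F, l x = c := by rw [hF]; exact fun x hx => hx.2
  set X := Q.sectionBound i φ m with hX
  set P := proj0 K φ with hP
  set S := Q.graph i l c ⁻¹' K with hS
  have hne : K.Nonempty := nonempty_of_measure_ne_zero hK0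
  -- A point of `K` farthest from the plane serves both as apex of the cone and as bound for the
  -- slab, because `l - c` is the height times the nonzero constant `l (Q.axes i)`.
  obtain ⟨z, hzK, hz⟩ := hK.exists_isMaxOn hne (f := fun x => |l x - c|)
    (by fun_prop)
  obtain ⟨⟨t₀, y₀⟩, rfl⟩ := Q.chart_surjective i z
  set H := |t₀ - Q.height i l c y₀| with hHdef
  have hH : ∀ t y, Q.chart i (t, y) ∈ K → |t - Q.height i l c y| ≤ H := by
    intro t y h
    have := hz h
    simp only [Set.mem_ofPred_eq, Q.apply_chart c hi, add_sub_cancel_left, abs_mul] at this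
    exact le_of_mul_le_mul_left this (abs_pos.2 hi)
  have e1 := Q.setLIntegral_face_sub_sq_le hφ hi hmax hFm (hFK.trans hKQ) hFl m
  have e2 := Q.setLIntegral_slab_sub_sq_le hφ hKm hKQ m hH
  have e3 : ENNReal.ofReal H * volume S ≤ 8 * volume K := Q.height_mul_volume_le hKc hKm hzK
  have e4 := enorm_proj0_sub_sq_mul_le (h0.continuousOn.integrableOn_compact hK) hK0 hKt m
  have e5 : μHE[2] F ≤ 3 * volume S := by
    have := Q.setLIntegral_face_le (i := i) hi hmax hFm hFl (f := 1) measurable_one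
    simp only [Pi.one_apply, lintegral_one, Measure.restrict_apply_univ] at this
    refine this.trans ?_
    gcongr
    exact Set.preimage_mono hFK
  -- The height `H` from the slab bound `e2` is absorbed by the cone bound `e3`, leaving a constant
  -- independent of the shape of `K`.
  have e6 : ‖P - m‖ₑ ^ 2 * volume S ≤ 16 * X := by
    refine (ENNReal.mul_le_mul_iff_right hK0 hKt).1 ?_
    calc volume K * (‖P - m‖ₑ ^ 2 * volume S) = (‖P - m‖ₑ ^ 2 * volume K) * volume S := by ring
      _ ≤ (ENNReal.ofReal (2 * H) * X) * volume S := mul_le_mul' (e4.trans e2) le_rfl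
      _ = 2 * X * (ENNReal.ofReal H * volume S) := by
          rw [ENNReal.ofReal_mul (by norm_num), ENNReal.ofReal_ofNat]; ring
      _ ≤ 2 * X * (8 * volume K) := by gcongr
      _ = volume K * (16 * X) := by ring
  calc ∫⁻ x in F, ‖φ x - P‖ₑ ^ 2 ∂μHE[2]
      ≤ ∫⁻ x in F, (2 * ‖φ x - m‖ₑ ^ 2 + 2 * ‖P - m‖ₑ ^ 2) ∂μHE[2] := by
        refine lintegral_mono fun x => ?_
        have := enorm_add_sq_le (φ x - m) (m - P)
        rw [sub_add_sub_cancel] at this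
        rwa [enorm_sub_rev P m]
    _ = 2 * (∫⁻ x in F, ‖φ x - m‖ₑ ^ 2 ∂μHE[2]) + 2 * ‖P - m‖ₑ ^ 2 * μHE[2] F := by
        rw [lintegral_add_right _ measurable_const,
          lintegral_const_mul _ (Continuous.measurable (by fun_prop)), setLIntegral_const]
    _ ≤ 2 * (3 * X) + 2 * ‖P - m‖ₑ ^ 2 * (3 * volume S) := by gcongr
    _ = 6 * X + 6 * (‖P - m‖ₑ ^ 2 * volume S) := by ring
    _ ≤ 6 * X + 6 * (16 * X) := by gcongr
    _ = 102 * X := by ring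

end Cut

/-! ### An intermediate cuboid of size comparable to `h_K`. -/

section Enclosing

lemma Cuboid.norm_sub_sq_eq (R : Cuboid) (x y : E3) :
    ‖x - y‖ ^ 2 = ∑ j, (R.axes.repr (x - R.corner) j - R.axes.repr (y - R.corner) j) ^ 2 := by
  rw [← R.axes.repr.norm_map, EuclideanSpace.norm_sq_eq]
  refine Finset.sum_congr rfl fun j _ => ?_
  rw [Real.norm_eq_abs, sq_abs, ← PiLp.sub_apply, ← map_sub, sub_sub_sub_cancel_right]

lemma Cuboid.norm_sub_sq_le (R : Cuboid) {a : ℝ} (ha : ∀ j, R.side j ≤ a) {x y : E3}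
    (hx : x ∈ R.toSet) (hy : y ∈ R.toSet) : ‖x - y‖ ^ 2 ≤ 3 * a ^ 2 := by
  rw [R.norm_sub_sq_eq]
  have : ∀ j, (R.axes.repr (x - R.corner) j - R.axes.repr (y - R.corner) j) ^ 2 ≤ a ^ 2 := by
    intro j
    have h1 := hx j
    have h2 := hy j
    have h3 := ha j
    refine sq_le_sq' ?_ ?_ <;> linarith [h1.1, h1.2, h2.1, h2.2]
  calc _ ≤ ∑ _j : Fin 3, a ^ 2 := Finset.sum_le_sum fun j _ => this j
    _ = _ := by simp

lemma Cuboid.isCompact_toSet (R : Cuboid) : IsCompact R.toSet := by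
  obtain ⟨i, hi⟩ := Finite.exists_max R.side
  refine Metric.isCompact_of_isClosed_isBounded R.isClosed_toSet ?_
  refine Metric.isBounded_iff.2 ⟨2 * R.side i, fun x hx y hy => ?_⟩
  rw [dist_eq_norm]
  have := R.norm_sub_sq_le hi hx hy
  refine le_of_sq_le_sq ?_ (by linarith [R.side_pos i])
  nlinarith [sq_nonneg (R.side i)]

lemma Cuboid.convex_toSet (R : Cuboid) : Convex ℝ R.toSet := by
  intro x hx y hy a b ha hb hab j
  have h : a • x + b • y - R.corner = a • (x - R.corner) + b • (y - R.corner) := by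
    have : R.corner = (a + b) • R.corner := by rw [hab, one_smul]
    conv_lhs => rw [this]
    module
  rw [h, map_add, map_smul, map_smul]
  exact convex_Icc (0 : ℝ) (R.side j) (hx j) (hy j) ha hb hab

lemma Cuboid.exists_enclosing (R : Cuboid) {κ : ℝ} (hκ : 1 ≤ κ)
    (hR : ∀ i j, R.side i ≤ κ * R.side j) {K : Set E3} (hK : IsCompact K) (hKR : K ⊆ R.toSet)
    (hd : 0 < Metric.diam K) :
    ∃ Q : Cuboid, K ⊆ Q.toSet ∧ Q.toSet ⊆ R.toSet ∧ (∀ i, Q.side i ≤ Metric.diam K) ∧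
      ∀ i, Metric.diam K ≤ 2 * κ * Q.side i := by
  set h := Metric.diam K with hh
  have hne : K.Nonempty := by
    rw [Set.nonempty_iff_ne_empty]
    rintro rfl
    simp [hh] at hd
  have hmin : ∀ i, ∃ a ∈ K, ∀ x ∈ K, R.axes.repr (a - R.corner) i ≤ R.axes.repr (x - R.corner) i :=
    fun i => by
      have hc : Continuous fun x => R.axes.repr (x - R.corner) := by fun_prop
      exact hK.exists_isMinOn hne
        ((EuclideanSpace.proj (𝕜 := ℝ) i).continuous.comp hc).continuousOn
  choose a haK ha using hmin
  have hdist : ∀ i, ∀ x ∈ K, R.axes.repr (x - R.corner) i ≤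
      R.axes.repr (a i - R.corner) i + h := by
    intro i x hx
    have h1 : dist x (a i) ≤ h := Metric.dist_le_diam_of_mem hK.isBounded hx (haK i)
    rw [dist_eq_norm] at h1
    have h2 := R.norm_sub_sq_eq x (a i)
    have h3 : (R.axes.repr (x - R.corner) i - R.axes.repr (a i - R.corner) i) ^ 2 ≤ h ^ 2 := by
      calc _ ≤ ∑ j, (R.axes.repr (x - R.corner) j - R.axes.repr (a i - R.corner) j) ^ 2 :=
            Finset.single_le_sum
              (f := fun j => (R.axes.repr (x - R.corner) j - R.axes.repr (a i - R.corner) j) ^ 2)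
              (fun j _ => sq_nonneg _) (Finset.mem_univ i)
        _ ≤ h ^ 2 := by rw [← h2]; gcongr
    linarith [abs_le_of_sq_le_sq' h3 hd.le |>.2]
  -- An edge of length `h` suffices to cover `K`, but it is truncated to the edge of `R`. The corner
  -- starts at the smallest coordinate of `K` and is moved back where needed to stay inside `R`.
  obtain ⟨q, hq⟩ : ∃ q : Fin 3 → ℝ, ∀ i, q i = min h (R.side i) := ⟨_, fun _ => rfl⟩
  obtain ⟨α, hα⟩ : ∃ α : Fin 3 → ℝ,
    ∀ i, α i = min (R.axes.repr (a i - R.corner) i) (R.side i - q i) := ⟨_, fun _ => rfl⟩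
  have hrepr : ∀ x j, R.axes.repr (x - (R.corner + R.axes.repr.symm (WithLp.toLp 2 α))) j =
      R.axes.repr (x - R.corner) j - α j := by
    intro x j
    rw [← sub_sub, map_sub, LinearIsometryEquiv.apply_symm_apply, PiLp.sub_apply]
  refine ⟨⟨R.corner + R.axes.repr.symm (WithLp.toLp 2 α), R.axes, q,
    fun i => (lt_min hd (R.side_pos i)).trans_eq (hq i).symm⟩, ?_, ?_, ?_, ?_⟩
  · intro x hx i
    have h1 := ha i x hx
    have h2 := hdist i x hx
    have h3 := hKR hx i
    have h4 := hKR (haK i) i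
    simp only [hrepr, hα, hq, Set.mem_Icc] at h3 h4 ⊢
    constructor
    · linarith [min_le_left (R.axes.repr (a i - R.corner) i) (R.side i - min h (R.side i))]
    · rcases min_cases (R.axes.repr (a i - R.corner) i) (R.side i - min h (R.side i)) with ⟨e, h5⟩ | ⟨e, h5⟩ <;>
      rcases min_cases h (R.side i) with ⟨e', h6⟩ | ⟨e', h6⟩ <;>
      rw [e] <;> linarith
  · intro x hx i
    have h1 := hx i
    have h4 := hKR (haK i) i
    simp only [hrepr, hα, hq, Set.mem_Icc] at h1 h4 ⊢
    have h5 := min_le_right (R.axes.repr (a i - R.corner) i) (R.side i - min h (R.side i))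
    have h6 : 0 ≤ min (R.axes.repr (a i - R.corner) i) (R.side i - min h (R.side i)) :=
      le_min h4.1 (sub_nonneg.2 (min_le_right _ _))
    exact ⟨by linarith, by linarith⟩
  · exact fun i => (hq i).trans_le (min_le_left _ _)
  · intro i
    have hκ0 : 0 < κ := by linarith
    rcases min_cases h (R.side i) with ⟨e', h6⟩ | ⟨e', h6⟩
    · simp only [hq, e']
      nlinarith
    -- When the edge of `Q` is a full edge of `R`, the ratio bound gives `diam K ≤ √3 κ (R.side i) ≤
    -- 2 κ (R.side i)`.
    · simp only [hq, e']
      have hs := R.side_pos i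
      refine Metric.diam_le_of_forall_dist_le (by positivity) fun x hx y hy => ?_
      have := R.norm_sub_sq_le (fun j => hR j i) (hKR hx) (hKR hy)
      rw [dist_eq_norm]
      refine le_of_sq_le_sq ?_ (by positivity)
      nlinarith [sq_nonneg (κ * R.side i)]

end Enclosing

/-! ### Geometry of faces and the estimates for smooth functions. -/

section Face

/-- The exposing functional is constant on its set of maximizers. It cannot vanish, since then `F =
K` would span three dimensions. -/
lemma IsFace.exists_eq {K F : Set E3} (hF : IsFace K F) (hK : (interior K).Nonempty) :
    ∃ (l : E3 →L[ℝ] ℝ) (c : ℝ), l ≠ 0 ∧ F = {x ∈ K | l x = c} := by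
  obtain ⟨hexp, hdim⟩ := hF
  have hne : F.Nonempty := by
    rw [Set.nonempty_iff_ne_empty]
    rintro rfl
    rw [vectorSpan_empty, finrank_bot] at hdim
    omega
  obtain ⟨l, hl⟩ := hexp hne
  obtain ⟨x₀, hx₀⟩ := hne
  have hx₀' := hx₀
  rw [hl] at hx₀'
  refine ⟨l, l x₀, ?_, ?_⟩
  · rintro rfl
    have hFK : F = K := by simpa using hl
    rw [hFK, ← direction_affineSpan, affineSpan_eq_top_of_nonempty_interior
      (hK.mono (interior_mono (subset_convexHull ℝ K))),
      AffineSubspace.direction_top, finrank_top, finrank_euclideanSpace_fin] at hdim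
    omega
  · rw [hl]
    ext x
    constructor
    · rintro ⟨hx, h⟩
      exact ⟨hx, le_antisymm (hx₀'.2 x hx) (h x₀ hx₀'.1)⟩
    · rintro ⟨hx, h⟩
      exact ⟨hx, fun y hy => (hx₀'.2 y hy).trans_eq h.symm⟩

variable {K F : Set E3} {R : Cuboid}

lemma IsCutFrom.subset (h : IsCutFrom K R) : K ⊆ R.toSet := by
  obtain ⟨n, c, -, rfl, -⟩ := h
  exact Set.inter_subset_left

lemma IsCutFrom.isCompact (h : IsCutFrom K R) : IsCompact K := by
  obtain ⟨n, c, -, rfl, -⟩ := h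
  exact R.isCompact_toSet.inter_right (isClosed_le (by fun_prop) continuous_const)

lemma IsCutFrom.convex (h : IsCutFrom K R) : Convex ℝ K := by
  obtain ⟨n, c, -, rfl, -⟩ := h
  exact R.convex_toSet.inter (convex_halfSpace_le (innerₗ E3 n).isLinear c)

lemma IsCutFrom.interior_nonempty (h : IsCutFrom K R) : (interior K).Nonempty := by
  obtain ⟨n, c, -, -, h⟩ := h
  exact h

lemma IsCutFrom.volume_ne_zero (h : IsCutFrom K R) : volume K ≠ 0 :=
  (Measure.measure_pos_of_nonempty_interior volume h.interior_nonempty).ne'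

lemma IsCutFrom.diam_pos (h : IsCutFrom K R) : 0 < Metric.diam K := by
  refine Metric.diam_pos (Set.not_subsingleton_iff.1 fun hs => ?_) h.isCompact.isBounded
  exact h.volume_ne_zero (hs.measure_zero volume)

lemma IsFace.subset (hF : IsFace K F) (hK : (interior K).Nonempty) : F ⊆ K := by
  obtain ⟨l, c, -, rfl⟩ := hF.exists_eq hK
  exact fun x hx => hx.1

lemma IsFace.isCompact (hF : IsFace K F) (hK : (interior K).Nonempty) (hKc : IsCompact K) :
    IsCompact F := by
  obtain ⟨l, c, -, rfl⟩ := hF.exists_eq hK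
  exact hKc.inter_right (isClosed_eq l.continuous continuous_const)

lemma IsFace.measure_lt_top (hF : IsFace K F) (hK : IsCutFrom K R) : μHE[2] F < ⊤ := by
  have hFm := (hF.isCompact hK.interior_nonempty hK.isCompact).isClosed.measurableSet
  have hFK := hF.subset hK.interior_nonempty
  obtain ⟨l, c, hl, hFe⟩ := hF.exists_eq hK.interior_nonempty
  obtain ⟨i, hi, hmax⟩ := exists_axis R hl
  have h := R.setLIntegral_face_le (i := i) (c := c) hi hmax hFm (by rw [hFe]; exact fun x hx => hx.2)
    (f := 1) measurable_one
  simp only [Pi.one_apply, lintegral_one, Measure.restrict_apply_univ] at h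
  refine h.trans_lt (ENNReal.mul_lt_top (by simp) ?_)
  refine (measure_mono (R.graph_preimage_subset_base (hFK.trans hK.subset))).trans_lt ?_
  exact isCompact_Icc.measure_lt_top

/-- The trace inequality for smooth functions on a face. -/
lemma IsFace.exists_trace_bound (hF : IsFace K F) (hK : IsCutFrom K R) :
    ∃ A : ℝ≥0∞, A ≠ ⊤ ∧ ∀ φ : E3 → ℝ, ContDiff ℝ 1 φ →
      eLpNorm φ 2 (μHE[2].restrict F) ^ 2 ≤ A * (eLpNorm φ 2 (volume.restrict R.toSet) ^ 2 +
        eLpNorm (gradient φ) 2 (volume.restrict R.toSet) ^ 2) := by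
  have hFm := (hF.isCompact hK.interior_nonempty hK.isCompact).isClosed.measurableSet
  have hFK := hF.subset hK.interior_nonempty
  obtain ⟨l, c, hl, hFe⟩ := hF.exists_eq hK.interior_nonempty
  obtain ⟨i, hi, hmax⟩ := exists_axis R hl
  have hs : ENNReal.ofReal (R.side i) ≠ 0 := by simpa using R.side_pos i
  refine ⟨3 * (2 / ENNReal.ofReal (R.side i) + 2 * ENNReal.ofReal (R.side i)), ?_,
    fun φ hφ => ?_⟩
  · exact ENNReal.mul_ne_top (by simp) (ENNReal.add_ne_top.2
      ⟨ENNReal.div_ne_top (by simp) hs, ENNReal.mul_ne_top (by simp) (by simp)⟩)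
  · have h := R.setLIntegral_face_sub_sq_le hφ (i := i) (c := c) hi hmax hFm
      (hFK.trans hK.subset) (by rw [hFe]; exact fun x hx => hx.2) 0
    simp only [sub_zero, Cuboid.sectionBound] at h
    simp only [eLpNorm_two_sq]
    refine h.trans ?_
    rw [mul_assoc 3, add_mul]
    gcongr
    · exact le_self_add
    · exact le_add_self

/-- The face estimate for smooth functions. -/
lemma IsFace.eLpNorm_sub_proj0_le {κ : ℝ} (hκ : 1 ≤ κ) (hR : ∀ i j, R.side i ≤ κ * R.side j)
    (hF : IsFace K F) (hK : IsCutFrom K R) {φ : E3 → ℝ} (hφ : ContDiff ℝ 1 φ) :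
    eLpNorm (fun x => φ x - proj0 K φ) 2 (μHE[2].restrict F) ≤
      ENNReal.ofReal (141 * √κ * √(Metric.diam K)) *
        eLpNorm (gradient φ) 2 (volume.restrict R.toSet) := by
  have hd := hK.diam_pos
  set h := Metric.diam K with hh
  obtain ⟨l, c, hl, hFe⟩ := hF.exists_eq hK.interior_nonempty
  obtain ⟨Q, hKQ, hQR, hQ1, hQ2⟩ := R.exists_enclosing hκ hR hK.isCompact hK.subset hd
  obtain ⟨i, hi, hmax⟩ := exists_axis Q hl
  have hD : ∀ x ∈ Q.toSet, ∀ y ∈ Q.toSet, ‖y - x‖ₑ ^ 2 ≤ ENNReal.ofReal (3 * h ^ 2) := by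
    intro x hx y hy
    rw [← ofReal_norm, ← ENNReal.ofReal_pow (norm_nonneg _)]
    exact ENNReal.ofReal_le_ofReal (Q.norm_sub_sq_le hQ1 hy hx)
  have hQ0 : volume Q.toSet ≠ 0 := fun h0 => hK.volume_ne_zero (measure_mono_null hKQ h0)
  obtain ⟨m, hm⟩ := exists_lintegral_sub_sq_le hφ Q.convex_toSet Q.isClosed_toSet.measurableSet hQ0
    Q.isCompact_toSet.measure_lt_top.ne hD
  have hface := Q.setLIntegral_face_sub_proj0_sq_le hφ hi hmax hK.convex hK.isCompact
    hK.volume_ne_zero hKQ hFe m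
  set I := ∫⁻ x in Q.toSet, ‖gradient φ x‖ₑ ^ 2 with hI
  have hs := Q.side_pos i
  have hκ0 : 0 < κ := by linarith
  -- From `h ≤ 2κ q` and `q ≤ h`, with `q` the edge of `Q`: `96 h² / q + 2q ≤ (192κ + 2) h ≤ 194 κ
  -- h`.
  have hbound : Q.sectionBound i φ m ≤ ENNReal.ofReal (194 * κ * h) * I := by
    rw [Cuboid.sectionBound, ← hI]
    calc _ ≤ 2 / ENNReal.ofReal (Q.side i) * (16 * ENNReal.ofReal (3 * h ^ 2) * I) +
          2 * ENNReal.ofReal (Q.side i) * I := by gcongr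
      _ = ENNReal.ofReal (2 / Q.side i * (16 * (3 * h ^ 2)) + 2 * Q.side i) * I := by
          rw [ENNReal.ofReal_add (by positivity) (by positivity),
            ENNReal.ofReal_mul (p := 2 / Q.side i) (by positivity),
            ENNReal.ofReal_mul (p := 16) (by positivity),
            ENNReal.ofReal_mul (p := 2) (by positivity), ENNReal.ofReal_div_of_pos hs]
          simp only [ENNReal.ofReal_ofNat]
          ring
      _ ≤ _ := by
          gcongr
          have h1 : h * (1 / Q.side i) ≤ 2 * κ := by
            rw [mul_one_div, div_le_iff₀ hs]; exact hQ2 i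
          have h2 := mul_le_mul_of_nonneg_left h1 hd.le
          have h3 : 2 / Q.side i * (16 * (3 * h ^ 2)) = 96 * (h * (h * (1 / Q.side i))) := by ring
          have h4 := hQ1 i
          nlinarith
  rw [← ENNReal.pow_le_pow_left_iff two_ne_zero, mul_pow, eLpNorm_two_sq, eLpNorm_two_sq,
    ← ENNReal.ofReal_pow (by positivity), mul_pow, mul_pow, Real.sq_sqrt hκ0.le, Real.sq_sqrt hd.le]
  calc _ ≤ 102 * Q.sectionBound i φ m := hface
    _ ≤ 102 * (ENNReal.ofReal (194 * κ * h) * I) := by gcongr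
    _ = ENNReal.ofReal (102 * (194 * κ * h)) * I := by
        rw [ENNReal.ofReal_mul (p := 102) (by norm_num), ENNReal.ofReal_ofNat, mul_assoc 102]
    _ ≤ _ := by
        refine mul_le_mul' (ENNReal.ofReal_le_ofReal ?_) (lintegral_mono_set hQR)
        -- The constant 141 comes from `102 · 194 = 19788 ≤ 19881 = 141²`.
        nlinarith [mul_pos hκ0 hd]

end Face

/-! ### Contraction followed by mollification in L². -/

section Smoothing

variable {E : Type*} [NormedAddCommGroup E] [NormedSpace ℝ E]

/-- Contraction towards `c` by the factor `s`, followed by mollification. -/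
noncomputable def smoothing (c : E3) (s : ℝ) (ρ : ContDiffBump (0 : E3)) (v : E3 → E) (x : E3) :
    E :=
  (ρ.normed volume ⋆[lsmul ℝ ℝ, volume] v) (c + s • (x - c))

variable (ρ : ContDiffBump (0 : E3))

lemma lintegral_ofReal_normed : ∫⁻ t, ENNReal.ofReal (ρ.normed volume t) = 1 := by
  rw [← ofReal_integral_eq_lintegral_ofReal ρ.integrable_normed
    (Eventually.of_forall ρ.nonneg_normed), ρ.integral_normed, ENNReal.ofReal_one]

/-- Mollification is a contraction on `L²`. -/
lemma lintegral_enorm_convolution_sq_le {v : E3 → E} (hv : StronglyMeasurable v) :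
    ∫⁻ z, ‖(ρ.normed volume ⋆[lsmul ℝ ℝ, volume] v) z‖ₑ ^ 2 ≤ ∫⁻ z, ‖v z‖ₑ ^ 2 := by
  obtain ⟨k, hk⟩ : ∃ k : E3 → ℝ≥0∞, ∀ t, k t = ENNReal.ofReal (ρ.normed volume t) :=
    ⟨_, fun _ => rfl⟩
  have hkm : Measurable k := by
    have : Measurable fun t => ENNReal.ofReal (ρ.normed volume t) :=
      (ENNReal.continuous_ofReal.comp ρ.continuous_normed).measurable
    exact (funext hk : k = _) ▸ this
  have hk1 : ∫⁻ t, k t = 1 := by simp only [hk]; exact lintegral_ofReal_normed ρ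
  have hw : ∀ z, Measurable fun t => ‖v (z - t)‖ₑ := fun z =>
    (hv.comp_measurable (measurable_const.sub measurable_id)).enorm
  have hw2 : Measurable fun p : E3 × E3 => ‖v (p.1 - p.2)‖ₑ :=
    (hv.comp_measurable (measurable_fst.sub measurable_snd)).enorm
  have hpt : ∀ z, ‖(ρ.normed volume ⋆[lsmul ℝ ℝ, volume] v) z‖ₑ ^ 2 ≤
      ∫⁻ t, k t * ‖v (z - t)‖ₑ ^ 2 := by
    intro z
    have h1 : ‖(ρ.normed volume ⋆[lsmul ℝ ℝ, volume] v) z‖ₑ ≤ ∫⁻ t, k t * ‖v (z - t)‖ₑ := by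
      rw [convolution_def]
      refine (enorm_integral_le_lintegral_enorm _).trans_eq (lintegral_congr fun t => ?_)
      rw [ContinuousLinearMap.lsmul_apply, enorm_smul, hk, Real.enorm_of_nonneg (ρ.nonneg_normed t)]
    -- Cauchy–Schwarz for the probability measure with density `k`, so no constant is lost.
    have h2 := sq_lintegral_le (volume.withDensity k) (hw z).aemeasurable
    rw [lintegral_withDensity_eq_lintegral_mul _ hkm (hw z),
      lintegral_withDensity_eq_lintegral_mul _ hkm ((hw z).pow_const 2),
      withDensity_apply _ MeasurableSet.univ, setLIntegral_univ, hk1, one_mul] at h2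
    exact (pow_le_pow_left₀ zero_le h1 2).trans h2
  calc _ ≤ ∫⁻ z, ∫⁻ t, k t * ‖v (z - t)‖ₑ ^ 2 := lintegral_mono hpt
    _ = ∫⁻ t, ∫⁻ z, k t * ‖v (z - t)‖ₑ ^ 2 :=
        lintegral_lintegral_swap ((hkm.comp measurable_snd).mul (hw2.pow_const 2)).aemeasurable
    _ = ∫⁻ t, k t * ∫⁻ z, ‖v z‖ₑ ^ 2 := by
        refine lintegral_congr fun t => ?_
        have hw3 : Measurable fun z => ‖v (z - t)‖ₑ ^ 2 :=
          (hv.comp_measurable (measurable_id.sub measurable_const)).enorm.pow_const 2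
        rw [lintegral_const_mul _ hw3]
        congr 1
        exact lintegral_sub_right_eq_self (fun z => ‖v z‖ₑ ^ 2) t
    _ = _ := by rw [lintegral_mul_const _ hkm, hk1, one_mul]

lemma continuous_convolution_normed {v : E3 → E} (hv : LocallyIntegrable v) :
    Continuous (ρ.normed volume ⋆[lsmul ℝ ℝ, volume] v) :=
  ρ.hasCompactSupport_normed.continuous_convolution_left _ ρ.continuous_normed hv

lemma continuous_smoothing {v : E3 → E} (hv : LocallyIntegrable v) (c : E3) (s : ℝ) :
    Continuous (smoothing c s ρ v) :=
  (continuous_convolution_normed ρ hv).comp (by fun_prop)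

lemma eLpNorm_smoothing_le {v : E3 → E} (hv : StronglyMeasurable v) (hvi : LocallyIntegrable v)
    (c : E3) {s : ℝ} (hs : s ∈ Set.Icc (1 / 2 : ℝ) 1) :
    eLpNorm (smoothing c s ρ v) 2 volume ≤ 3 * eLpNorm v 2 volume := by
  have h := setLIntegral_comp_homothety_le
    (G := fun z => ‖(ρ.normed volume ⋆[lsmul ℝ ℝ, volume] v) z‖ₑ ^ 2)
    ((continuous_convolution_normed ρ hvi).enorm.measurable.pow_const 2) convex_univ
    MeasurableSet.univ (Set.mem_univ c) hs
  rw [setLIntegral_univ, setLIntegral_univ] at h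
  rw [← ENNReal.pow_le_pow_left_iff two_ne_zero, mul_pow, eLpNorm_two_sq, eLpNorm_two_sq]
  calc _ ≤ 8 * _ := h
    _ ≤ 3 ^ 2 * _ := mul_le_mul' (by norm_num) (lintegral_enorm_convolution_sq_le ρ hv)

lemma smoothing_sub {v w : E3 → E} (hv : LocallyIntegrable v) (hw : LocallyIntegrable w) (c : E3)
    (s : ℝ) (x : E3) :
    smoothing c s ρ (v - w) x = smoothing c s ρ v x - smoothing c s ρ w x := by
  have h := fun {f : E3 → E} (hf : LocallyIntegrable f) =>
    (ρ.hasCompactSupport_normed (μ := volume)).convolutionExists_left (lsmul ℝ ℝ)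
      ρ.continuous_normed hf (c + s • (x - c))
  have h1 := ConvolutionExistsAt.distrib_add (h (hv.sub hw)) (h hw)
  rw [sub_add_cancel] at h1
  rw [smoothing, smoothing, smoothing, h1, add_sub_cancel_right]

variable [CompleteSpace E]

/-- Smoothing approximates `L²` functions on bounded sets. -/
lemma tendsto_eLpNorm_smoothing_sub {c : E3} {s : ℕ → ℝ} {ρ : ℕ → ContDiffBump (0 : E3)}
    (hs : ∀ k, s k ∈ Set.Icc (1 / 2 : ℝ) 1) (hs1 : Tendsto s atTop (𝓝 1))
    (hρ : Tendsto (fun k => (ρ k).rOut) atTop (𝓝 0)) {D : Set E3} (hD : Bornology.IsBounded D)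
    (hDm : MeasurableSet D)
    {v : E3 → E} (hv : StronglyMeasurable v) (hv2 : MemLp v 2 volume) :
    Tendsto (fun k => eLpNorm (fun x => smoothing c (s k) (ρ k) v x - v x) 2 (volume.restrict D))
      atTop (𝓝 0) := by
  have hvi : LocallyIntegrable v := hv2.locallyIntegrable (by norm_num)
  refine ENNReal.tendsto_nhds_zero.2 fun ε hε => ?_
  -- Five shares: 3 for smoothing `v - w` (`8 ≤ 3²`), one for the uniform approximation of `w`, one
  -- for `w - v`.
  set δ := ε / 5 with hδ
  have hδ0 : δ ≠ 0 := (ENNReal.div_pos hε.ne' (by norm_num)).ne'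
  obtain ⟨w, hwc, hwδ, hwcont, hw2⟩ := hv2.exists_hasCompactSupport_eLpNorm_sub_le
    (by norm_num) hδ0
  have hwi : LocallyIntegrable w := hwcont.locallyIntegrable
  have hunif : ∀ᶠ k in atTop, eLpNorm (fun x => smoothing c (s k) (ρ k) w x - w x) 2
      (volume.restrict D) ≤ δ := by
    obtain ⟨η, hη0, hη⟩ : ∃ η : ℝ, 0 < η ∧
        volume D ^ (1 / 2 : ℝ) * ENNReal.ofReal (2 * η) ≤ δ := by
      have ht : Tendsto (fun η : ℝ => volume D ^ (1 / 2 : ℝ) * ENNReal.ofReal (2 * η)) (𝓝 0)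
          (𝓝 (volume D ^ (1 / 2 : ℝ) * ENNReal.ofReal (2 * 0))) := by
        refine ENNReal.Tendsto.const_mul ?_ (Or.inr ?_)
        · exact (ENNReal.continuous_ofReal.comp (continuous_const.mul continuous_id)).tendsto 0
        · exact ENNReal.rpow_ne_top_of_nonneg (by norm_num) hD.measure_lt_top.ne
      simp only [mul_zero, ENNReal.ofReal_zero] at ht
      have := (ENNReal.tendsto_nhds_zero.1 ht δ hδ0.bot_lt)
      obtain ⟨η, h1, h2⟩ := ((this.filter_mono nhdsWithin_le_nhds).and
        (self_mem_nhdsWithin (a := (0 : ℝ)) (s := Set.Ioi 0))).exists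
      exact ⟨η, h2, h1⟩
    obtain ⟨r, hr0, hr⟩ := Metric.uniformContinuous_iff.1
      (hwc.uniformContinuous_of_continuous hwcont) η hη0
    obtain ⟨M, hM⟩ := hD.subset_closedBall c
    have hlim : Tendsto (fun k => (1 - s k) * M) atTop (𝓝 0) := by
      simpa using (hs1.const_sub 1).mul_const M
    filter_upwards [hρ.eventually_lt_const hr0, hlim.eventually_lt_const hr0] with k hk1 hk2
    -- One `η` pays for the mollification and one for the displacement by the contraction, both
    -- through uniform continuity of `w`.
    have hpt : ∀ x ∈ D, ‖smoothing c (s k) (ρ k) w x - w x‖ ≤ 2 * η := by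
      intro x hx
      set z := c + s k • (x - c) with hz
      have h1 : dist (smoothing c (s k) (ρ k) w x) (w z) ≤ η :=
        (ρ k).dist_normed_convolution_le hwcont.aestronglyMeasurable
          fun y hy => (hr ((Metric.mem_ball.1 hy).trans hk1)).le
      have h2 : dist (w z) (w x) ≤ η := by
        refine (hr ?_).le
        have : z - x = (1 - s k) • (c - x) := by rw [hz]; module
        rw [dist_eq_norm, this, norm_smul, Real.norm_of_nonneg (by linarith [(hs k).2])]
        refine lt_of_le_of_lt ?_ hk2
        gcongr
        · linarith [(hs k).2]
        · rw [← dist_eq_norm, dist_comm]; exact hM hx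
      rw [← dist_eq_norm]
      linarith [dist_triangle (smoothing c (s k) (ρ k) w x) (w z) (w x)]
    have h3 := eLpNorm_le_of_ae_bound (p := 2) (μ := volume.restrict D)
      ((ae_restrict_iff' hDm).2 (Eventually.of_forall hpt))
    refine h3.trans (le_trans (le_of_eq ?_) hη)
    simp
  filter_upwards [hunif] with k hk
  have hSv := continuous_smoothing (ρ k) hvi c (s k)
  have hSw := continuous_smoothing (ρ k) hwi c (s k)
  have e1 : eLpNorm (smoothing c (s k) (ρ k) (v - w)) 2 (volume.restrict D) ≤ 3 * δ := by
    refine (eLpNorm_restrict_le _ _ _ _).trans ((eLpNorm_smoothing_le (ρ k)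
      (hv.sub hwcont.stronglyMeasurable) (hvi.sub hwi) c (hs k)).trans ?_)
    gcongr
  have e2 : eLpNorm (w - v) 2 (volume.restrict D) ≤ δ := by
    refine (eLpNorm_restrict_le _ _ _ _).trans ?_
    rwa [eLpNorm_sub_comm]
  have heq : (fun x => smoothing c (s k) (ρ k) v x - v x) =
      smoothing c (s k) (ρ k) (v - w) + ((fun x => smoothing c (s k) (ρ k) w x - w x) + (w - v)) := by
    ext x
    simp only [Pi.add_apply, Pi.sub_apply, smoothing_sub (ρ k) hvi hwi]
    abel
  have m1 : AEStronglyMeasurable (smoothing c (s k) (ρ k) (v - w)) (volume.restrict D) :=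
    (continuous_smoothing (ρ k) (hvi.sub hwi) c (s k)).aestronglyMeasurable
  have m2 : AEStronglyMeasurable (fun x => smoothing c (s k) (ρ k) w x - w x)
    (volume.restrict D) := (hSw.sub hwcont).aestronglyMeasurable
  have m3 : AEStronglyMeasurable (w - v) (volume.restrict D) :=
    (hwcont.stronglyMeasurable.sub hv).aestronglyMeasurable
  rw [heq]
  refine (eLpNorm_add_le m1 (m2.add m3) (by norm_num)).trans ?_
  calc _ ≤ 3 * δ + (δ + δ) := add_le_add e1
        ((eLpNorm_add_le m2 m3 (by norm_num)).trans (add_le_add hk e2))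
    _ = 5 * (ε / 5) := by rw [hδ]; ring
    _ = ε := ENNReal.mul_div_cancel (by norm_num) (by norm_num)
    _ ≤ ε := le_rfl

end Smoothing

/-! ### Density of smooth functions in H¹ of a convex body. -/

section Density

lemma inner_gradient (φ : E3 → ℝ) (x e : E3) : inner ℝ (gradient φ x) e = fderiv ℝ φ x e := by
  simp [gradient, InnerProductSpace.toDual_symm_apply]

variable {D : Set E3} {u : E3 → ℝ} {g : E3 → E3}

/-- Mollification commutes with the weak gradient inside `D`. -/
lemma IsH1.gradient_convolution (h : IsH1 D u g) (hD : MeasurableSet D) (hDt : volume D ≠ ⊤)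
    {v : E3 → ℝ} {G : E3 → E3} (hv : v =ᵐ[volume] D.indicator u)
    (hG : G =ᵐ[volume] D.indicator g) (hvi : LocallyIntegrable v)
    (ρ : ContDiffBump (0 : E3)) {z : E3} (hz : Metric.closedBall z ρ.rOut ⊆ interior D) :
    gradient (ρ.normed volume ⋆[lsmul ℝ ℝ, volume] v) z =
      (ρ.normed volume ⋆[lsmul ℝ ℝ, volume] G) z := by
  have : IsFiniteMeasure (volume.restrict D) := isFiniteMeasure_restrict.2 hDt
  set k := ρ.normed (volume : Measure E3) with hk
  have hks : ContDiff ℝ ∞ k := ρ.contDiff_normed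
  have hkc : HasCompactSupport k := ρ.hasCompactSupport_normed
  -- The reflected kernel is an admissible test function precisely because its supporting ball lies
  -- in the interior of `D`.
  set ψ : E3 → ℝ := fun y => k (z - y) with hψ
  have hψs : ContDiff ℝ ∞ ψ := hks.comp (contDiff_const.sub contDiff_id)
  have hψsupp : tsupport ψ ⊆ Metric.closedBall z ρ.rOut := by
    refine closure_minimal (fun y hy => ?_) Metric.isClosed_closedBall
    have : z - y ∈ Function.support k := hy
    rw [hk, ρ.support_normed_eq, mem_ball_zero_iff] at this
    rw [mem_closedBall_iff_norm']
    exact this.le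
  have hψc : HasCompactSupport ψ :=
    (isCompact_closedBall z ρ.rOut).of_isClosed_subset (isClosed_tsupport ψ) hψsupp
  have hweak := h.weak_grad ψ hψs hψc (hψsupp.trans hz)
  have hgψ : ∀ y e, inner ℝ (gradient ψ y) e = -(fderiv ℝ k (z - y) e) := by
    intro y e
    have h1 : HasFDerivAt k (fderiv ℝ k (z - y)) (z - y) :=
      (hks.differentiable (by norm_num) _).hasFDerivAt
    have h2 := h1.comp y ((hasFDerivAt_id y).const_sub z)
    have h3 : fderiv ℝ ψ y = _ := h2.fderiv
    rw [inner_gradient, h3]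
    simp
  have hR : (k ⋆[lsmul ℝ ℝ, volume] G) z = ∫ y in D, ψ y • g y := by
    rw [convolution_lsmul_swap, ← integral_indicator hD]
    refine integral_congr_ae (hG.mono fun t ht => ?_)
    simp only [ht, hψ]
    by_cases htD : t ∈ D <;> simp [htD]
  have hψ1 : ContDiff ℝ 1 ψ := hψs.of_le (by exact_mod_cast le_top)
  have hint : Integrable (fun x => u x • gradient ψ x) (volume.restrict D) := by
    have hgc : HasCompactSupport (gradient ψ) :=
      (hψc.fderiv ℝ).comp_left (g := (InnerProductSpace.toDual ℝ E3).symm) (map_zero _)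
    have hg2 : MemLp (gradient ψ) 2 (volume.restrict D) :=
      (continuous_gradient hψ1).memLp_of_hasCompactSupport hgc
    exact memLp_one_iff_integrable.1 (hg2.smul h.memLp)
  refine ext_inner_right ℝ fun e => ?_
  have hder := hkc.hasFDerivAt_convolution_right (lsmul ℝ ℝ : ℝ →L[ℝ] ℝ →L[ℝ] ℝ).flip hvi
    (hks.of_le (by exact_mod_cast le_top)) z
  rw [convolution_flip] at hder
  have hex := (hkc.fderiv ℝ).convolutionExists_right
    ((lsmul ℝ ℝ : ℝ →L[ℝ] ℝ →L[ℝ] ℝ).flip.precompR E3) hvi (hks.continuous_fderiv (by norm_num)) z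
  rw [inner_gradient, hder.fderiv, hR, convolution_def, ContinuousLinearMap.integral_apply hex,
    ← neg_neg (∫ y in D, ψ y • g y), ← hweak, inner_neg_left, real_inner_comm,
    ← integral_inner hint, ← integral_neg, ← integral_indicator hD]
  refine integral_congr_ae (hv.mono fun t ht => ?_)
  simp only [ContinuousLinearMap.precompR_apply, ht]
  by_cases htD : t ∈ D
  · simp only [Set.indicator_of_mem htD, inner_smul_right]
    rw [real_inner_comm, hgψ]
    change fderiv ℝ k (z - t) e * u t = _
    ring
  · simp [htD]

lemma gradient_comp_homothety {f : E3 → ℝ} (hf : ContDiff ℝ 1 f) (c : E3) (s : ℝ) (x : E3) :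
    gradient (fun x => f (c + s • (x - c))) x = s • gradient f (c + s • (x - c)) := by
  refine ext_inner_right ℝ fun e => ?_
  have h1 : HasFDerivAt f (fderiv ℝ f (c + s • (x - c))) (c + s • (x - c)) :=
    (hf.differentiable one_ne_zero _).hasFDerivAt
  have h2 := h1.comp x ((((hasFDerivAt_id x).sub_const c).const_smul s).const_add c)
  have h3 : fderiv ℝ (fun x => f (c + s • (x - c))) x = _ := h2.fderiv
  rw [inner_gradient, h3, inner_smul_left, inner_gradient]
  simp

/-- Density of smooth functions in `H¹` of a convex body. -/
lemma IsH1.exists_smooth_approx (h : IsH1 D u g) (hDc : IsCompact D) (hconv : Convex ℝ D)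
    (hint : (interior D).Nonempty) :
    ∃ φ : ℕ → E3 → ℝ, (∀ k, ContDiff ℝ ∞ (φ k)) ∧
      Tendsto (fun k => eLpNorm (fun x => φ k x - u x) 2 (volume.restrict D)) atTop (𝓝 0) ∧
      Tendsto (fun k => eLpNorm (fun x => gradient (φ k) x - g x) 2 (volume.restrict D))
        atTop (𝓝 0) := by
  obtain ⟨c, hc⟩ := hint
  obtain ⟨r, hr0, hr⟩ := Metric.isOpen_iff.1 isOpen_interior c hc
  have hDm := hDc.isClosed.measurableSet
  -- The shift by 2 makes `ε k ≤ 1/2`, so the contraction factors stay in `[1/2, 1]`.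
  obtain ⟨ε, hε⟩ : ∃ ε : ℕ → ℝ, ∀ k, ε k = 1 / ((k : ℝ) + 1 + 1) := ⟨_, fun _ => rfl⟩
  have hε0 : ∀ k, 0 < ε k := fun k => by rw [hε]; positivity
  have hε1 : ∀ k, ε k ≤ 1 / 2 := fun k => by
    rw [hε]
    gcongr
    linarith [(Nat.cast_nonneg k : (0 : ℝ) ≤ k)]
  have hεlim : Tendsto ε atTop (𝓝 0) := by
    have := (tendsto_add_atTop_iff_nat 1).2 (tendsto_one_div_add_atTop_nhds_zero_nat (𝕜 := ℝ))
    refine this.congr fun k => ?_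
    rw [hε]
    push_cast
    rfl
  have hρpos : ∀ k, 0 < ε k * (r / 4) ∧ ε k * (r / 4) < ε k * (r / 2) := fun k =>
    ⟨mul_pos (hε0 k) (by linarith), by nlinarith [hε0 k]⟩
  set ρ : ℕ → ContDiffBump (0 : E3) := fun k =>
    ⟨ε k * (r / 4), ε k * (r / 2), (hρpos k).1, (hρpos k).2⟩ with hρ
  set s : ℕ → ℝ := fun k => 1 - ε k with hs
  have hsmem : ∀ k, s k ∈ Set.Icc (1 / 2 : ℝ) 1 := fun k =>
    ⟨by simp only [hs]; linarith [hε1 k], by simp only [hs]; linarith [hε0 k]⟩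
  have hs1 : Tendsto s atTop (𝓝 1) := by simpa using hεlim.const_sub 1
  have hρlim : Tendsto (fun k => (ρ k).rOut) atTop (𝓝 0) := by
    simpa using hεlim.mul_const (r / 2)
  set u' := h.memLp.aestronglyMeasurable.mk u
  set g' := h.memLp_grad.aestronglyMeasurable.mk g
  have hu' : u =ᵐ[volume.restrict D] u' := h.memLp.aestronglyMeasurable.ae_eq_mk
  have hg' : g =ᵐ[volume.restrict D] g' := h.memLp_grad.aestronglyMeasurable.ae_eq_mk
  set v := D.indicator u' with hv
  set G := D.indicator g' with hG
  have hvm : StronglyMeasurable v :=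
    h.memLp.aestronglyMeasurable.stronglyMeasurable_mk.indicator hDm
  have hGm : StronglyMeasurable G :=
    h.memLp_grad.aestronglyMeasurable.stronglyMeasurable_mk.indicator hDm
  have hv2 : MemLp v 2 volume := (memLp_indicator_iff_restrict hDm).2 (h.memLp.ae_eq hu')
  have hG2 : MemLp G 2 volume := (memLp_indicator_iff_restrict hDm).2 (h.memLp_grad.ae_eq hg')
  have hvi : LocallyIntegrable v := hv2.locallyIntegrable (by norm_num)
  have hGi : LocallyIntegrable G := hG2.locallyIntegrable (by norm_num)
  have hvu : v =ᵐ[volume] D.indicator u :=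
    ((ae_restrict_iff' hDm).1 hu').mono fun x hx => by
      by_cases hxD : x ∈ D
      · simp [hv, hxD, hx hxD]
      · simp [hv, hxD]
  have hGg : G =ᵐ[volume] D.indicator g :=
    ((ae_restrict_iff' hDm).1 hg').mono fun x hx => by
      by_cases hxD : x ∈ D
      · simp [hG, hxD, hx hxD]
      · simp [hG, hxD]
  have hvuD : ∀ᵐ x ∂volume.restrict D, v x = u x := by
    filter_upwards [hu', ae_restrict_mem hDm] with x hx hxD
    simp [hv, hxD, hx]
  have hGgD : ∀ᵐ x ∂volume.restrict D, G x = g x := by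
    filter_upwards [hg', ae_restrict_mem hDm] with x hx hxD
    simp [hG, hxD, hx]
  have hsm : ∀ k, ContDiff ℝ ∞ ((ρ k).normed volume ⋆[lsmul ℝ ℝ, volume] v) := fun k =>
    (ρ k).hasCompactSupport_normed.contDiff_convolution_left _ (ρ k).contDiff_normed hvi
  have hgrad : ∀ k, ∀ x ∈ D, gradient (smoothing c (s k) (ρ k) v) x =
      s k • smoothing c (s k) (ρ k) G x := by
    intro k x hx
    have h1 := gradient_comp_homothety ((hsm k).of_le (by exact_mod_cast le_top)) c (s k) x
    refine h1.trans ?_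
    congr 1
    refine h.gradient_convolution hDm hDc.measure_lt_top.ne hvu hGg hvi (ρ k) fun y hy => ?_
    -- A point `y` within `ε r / 2` of the contracted point is `(1 - ε) x + ε y'` with `y'` in the
    -- ball of radius `r` about `c`; convexity puts it in the interior. This is why the contraction
    -- precedes the mollification and the radii are proportional to `ε`.
    have hy' : c + (ε k)⁻¹ • (y - (c + s k • (x - c))) ∈ interior D := by
      refine hr ?_
      rw [mem_ball_iff_norm, add_sub_cancel_left, norm_smul, norm_inv,
        Real.norm_of_nonneg (hε0 k).le, inv_mul_lt_iff₀ (hε0 k)]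
      rw [mem_closedBall_iff_norm] at hy
      refine hy.trans_lt ?_
      change ε k * (r / 2) < ε k * r
      nlinarith [mul_pos (hε0 k) hr0]
    have h2 := hconv.combo_self_interior_mem_interior hx hy' (a := s k) (b := ε k)
      (by linarith [(hsmem k).1]) (hε0 k) (by simp [hs])
    convert h2 using 1
    rw [smul_add, smul_smul, mul_inv_cancel₀ (hε0 k).ne', hs]
    module
  refine ⟨fun k => smoothing c (s k) (ρ k) v, fun k => ?_, ?_, ?_⟩
  · exact (hsm k).comp (by fun_prop)
  · refine (tendsto_eLpNorm_smoothing_sub (c := c) hsmem hs1 hρlim hDc.isBounded hDm hvm hv2).congr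
      fun k => eLpNorm_congr_ae (hvuD.mono fun x hx => ?_)
    simp only [hx]
  · have hlim := tendsto_eLpNorm_smoothing_sub (c := c) hsmem hs1 hρlim hDc.isBounded hDm hGm hG2
    have hlim2 : Tendsto (fun k => ‖ε k‖ₑ * eLpNorm G 2 (volume.restrict D)) atTop (𝓝 0) := by
      have h1 : Tendsto (fun k => ‖ε k‖ₑ) atTop (𝓝 0) := by simpa using hεlim.enorm
      simpa using ENNReal.Tendsto.mul_const h1 (Or.inr (hG2.restrict D).eLpNorm_ne_top)
    have hsum := hlim.add hlim2
    rw [add_zero] at hsum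
    refine tendsto_of_tendsto_of_tendsto_of_le_of_le tendsto_const_nhds hsum (fun _ => zero_le)
      fun k => ?_
    -- Contraction multiplies the gradient by `s = 1 - ε`, which leaves the extra term `-ε G`.
    have heq : ∀ᵐ x ∂volume.restrict D, gradient (smoothing c (s k) (ρ k) v) x - g x =
        (s k • (fun x => smoothing c (s k) (ρ k) G x - G x) + (-(ε k)) • G) x := by
      filter_upwards [hGgD, ae_restrict_mem hDm] with x hx hxD
      rw [hgrad k x hxD, ← hx]
      simp only [Pi.add_apply, Pi.smul_apply, hs]
      module
    have m1 : AEStronglyMeasurable (fun x => smoothing c (s k) (ρ k) G x - G x)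
        (volume.restrict D) :=
      (continuous_smoothing (ρ k) hGi c (s k)).aestronglyMeasurable.sub hGm.aestronglyMeasurable
    change eLpNorm (fun x => gradient (smoothing c (s k) (ρ k) v) x - g x) 2 (volume.restrict D) ≤ _
    rw [eLpNorm_congr_ae heq]
    refine (eLpNorm_add_le (m1.const_smul _) (hGm.aestronglyMeasurable.const_smul _)
      (by norm_num)).trans (add_le_add ?_ ?_)
    · rw [eLpNorm_const_smul]
      refine mul_le_of_le_one_left zero_le ?_
      rw [Real.enorm_of_nonneg (by linarith [(hsmem k).1]), ← ENNReal.ofReal_one]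
      exact ENNReal.ofReal_le_ofReal (hsmem k).2
    · rw [eLpNorm_const_smul, enorm_neg]

end Density

/-! ### Existence of the trace and passage to the limit. -/

section Trace

lemma gradient_sub {φ ψ : E3 → ℝ} (hφ : ContDiff ℝ 1 φ) (hψ : ContDiff ℝ 1 ψ) :
    gradient (φ - ψ) = gradient φ - gradient ψ := by
  ext1 x
  refine ext_inner_right ℝ fun e => ?_
  rw [Pi.sub_apply, inner_sub_left, inner_gradient, inner_gradient, inner_gradient,
    fderiv_sub (hφ.differentiable one_ne_zero x) (hψ.differentiable one_ne_zero x)]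
  rfl

variable {K F : Set E3} {R : Cuboid} {u : E3 → ℝ} {g : E3 → E3}

lemma IsFace.memLp_of_continuous (hF : IsFace K F) (hK : IsCutFrom K R) {φ : E3 → ℝ}
    (hφ : Continuous φ) : MemLp φ 2 (μHE[2].restrict F) := by
  have hFc := hF.isCompact hK.interior_nonempty hK.isCompact
  have : IsFiniteMeasure ((μHE[2] : Measure E3).restrict F) :=
    isFiniteMeasure_restrict.2 (hF.measure_lt_top hK).ne
  obtain ⟨M, hM⟩ := hFc.exists_bound_of_continuousOn hφ.continuousOn
  exact MemLp.of_bound hφ.aestronglyMeasurable M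
    ((ae_restrict_iff' hFc.isClosed.measurableSet).2 (Eventually.of_forall hM))

lemma eLpNorm_sub_le_of_approx {α E : Type*} [MeasurableSpace α] {μ : Measure α}
    [NormedAddCommGroup E] {a b v : α → E} (ha : AEStronglyMeasurable a μ)
    (hb : AEStronglyMeasurable b μ) (hv : AEStronglyMeasurable v μ) :
    eLpNorm (a - b) 2 μ ≤ eLpNorm (fun x => a x - v x) 2 μ + eLpNorm (fun x => b x - v x) 2 μ := by
  have h := eLpNorm_sub_le (ha.sub hv) (hb.sub hv) (p := 2) (by norm_num)
  rwa [sub_sub_sub_cancel_right] at h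

/-- Smooth functions converging in `H¹(R)` converge in `L²` on every face. -/
lemma IsFace.exists_trace (hF : IsFace K F) (hK : IsCutFrom K R) (hu : IsH1 R.toSet u g) :
    ∃ γ, IsTrace R.toSet F u g γ := by
  obtain ⟨φ, hφ, hφu, hφg⟩ := hu.exists_smooth_approx R.isCompact_toSet R.convex_toSet
    (hK.interior_nonempty.mono (interior_mono hK.subset))
  obtain ⟨A, hA, hbound⟩ := hF.exists_trace_bound hK
  have hφ1 : ∀ k, ContDiff ℝ 1 (φ k) := fun k => (hφ k).of_le (by exact_mod_cast le_top)
  have hmem : ∀ k, MemLp (φ k) 2 (μHE[2].restrict F) := fun k =>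
    hF.memLp_of_continuous hK (hφ1 k).continuous
  set a := fun k => eLpNorm (fun x => φ k x - u x) 2 (volume.restrict R.toSet)
  set b := fun k => eLpNorm (fun x => gradient (φ k) x - g x) 2 (volume.restrict R.toSet)
  -- The factor `A + 1` replaces `√A`, by `A ≤ (A + 1)²`.
  have hle : ∀ n m, eLpNorm (φ n - φ m) 2 (μHE[2].restrict F) ≤
      (A + 1) * ((a n + b n) + (a m + b m)) := by
    intro n m
    have h1 := hbound (φ n - φ m) ((hφ1 n).sub (hφ1 m))
    rw [gradient_sub (hφ1 n) (hφ1 m)] at h1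
    have h2 : eLpNorm (φ n - φ m) 2 (volume.restrict R.toSet) ≤ a n + a m :=
      eLpNorm_sub_le_of_approx (hφ1 n).continuous.aestronglyMeasurable
        (hφ1 m).continuous.aestronglyMeasurable hu.memLp.aestronglyMeasurable
    have h3 : eLpNorm (gradient (φ n) - gradient (φ m)) 2 (volume.restrict R.toSet) ≤
        b n + b m :=
      eLpNorm_sub_le_of_approx (continuous_gradient (hφ1 n)).aestronglyMeasurable
        (continuous_gradient (hφ1 m)).aestronglyMeasurable hu.memLp_grad.aestronglyMeasurable
    rw [← ENNReal.pow_le_pow_left_iff two_ne_zero]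
    refine h1.trans ?_
    calc A * (_ ^ 2 + _ ^ 2) ≤ (A + 1) ^ 2 * ((a n + a m) + (b n + b m)) ^ 2 := by
          refine mul_le_mul' ?_ ?_
          · calc A ≤ A ^ 2 + 2 * A + 1 := by
                  rw [add_assoc, two_mul]
                  exact le_add_left (le_add_right le_self_add)
              _ = (A + 1) ^ 2 := by ring
          · calc _ ≤ (a n + a m) ^ 2 + (b n + b m) ^ 2 := by gcongr
              _ ≤ (a n + a m) ^ 2 + (b n + b m) ^ 2 + 2 * ((a n + a m) * (b n + b m)) :=
                le_self_add
              _ = _ := by ring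
      _ = _ := by ring
  have hlim : Tendsto (fun p : ℕ × ℕ => (A + 1) * ((a p.1 + b p.1) + (a p.2 + b p.2)))
      atTop (𝓝 0) := by
    have hab : Tendsto (fun k => a k + b k) atTop (𝓝 0) := by simpa using hφu.add hφg
    have h1 : Tendsto (fun p : ℕ × ℕ => (a p.1 + b p.1) + (a p.2 + b p.2)) atTop (𝓝 0) := by
      rw [← prod_atTop_atTop_eq]
      simpa using (hab.comp tendsto_fst).add (hab.comp tendsto_snd)
    simpa using ENNReal.Tendsto.const_mul h1 (Or.inr (ENNReal.add_ne_top.2 ⟨hA, by simp⟩))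
  have hcauchy : CauchySeq fun k => (hmem k).toLp (φ k) := by
    have : Fact ((1 : ℝ≥0∞) ≤ 2) := ⟨by norm_num⟩
    rw [Lp.cauchySeq_Lp_iff_cauchySeq_eLpNorm]
    refine tendsto_of_tendsto_of_tendsto_of_le_of_le tendsto_const_nhds hlim (fun _ => zero_le)
      fun p => ?_
    refine le_trans (le_of_eq (eLpNorm_congr_ae ?_)) (hle p.1 p.2)
    exact (hmem p.1).coeFn_toLp.sub (hmem p.2).coeFn_toLp
  obtain ⟨γ, hγ⟩ := cauchySeq_tendsto_of_complete hcauchy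
  refine ⟨γ, Lp.memLp γ, φ, hφ, hφu, hφg, ?_⟩
  rw [Lp.tendsto_Lp_iff_tendsto_eLpNorm'] at hγ
  refine hγ.congr fun k => eLpNorm_congr_ae ?_
  exact (hmem k).coeFn_toLp.sub (EventuallyEq.refl _ _)

/-- L² continuity of the mean for fixed `K`. The constant blows up as `K` shrinks, which is
harmless: it only multiplies a null sequence in the limit. -/
lemma enorm_proj0_sub_proj0_le (hK : IsCutFrom K R) {φ : E3 → ℝ} (hφ : Continuous φ)
    (hu : MemLp u 2 (volume.restrict R.toSet)) :
    ‖proj0 K φ - proj0 K u‖ₑ ≤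
      ((volume K)⁻¹ + 1) * eLpNorm (fun x => φ x - u x) 2 (volume.restrict R.toSet) := by
  have hV0 := hK.volume_ne_zero
  have hVt : volume K ≠ ⊤ := hK.isCompact.measure_lt_top.ne
  have : IsFiniteMeasure (volume.restrict K) := isFiniteMeasure_restrict.2 hVt
  have hui : IntegrableOn u K :=
    (hu.mono_measure (Measure.restrict_mono hK.subset le_rfl)).integrable (by norm_num)
  have hφi : IntegrableOn φ K := hφ.continuousOn.integrableOn_compact hK.isCompact
  have h1 := enorm_proj0_sub_sq_mul_le (hφi.sub hui) hV0 hVt 0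
  have h2 : proj0 K (φ - u) = proj0 K φ - proj0 K u := by
    simp only [proj0, setAverage_eq, Pi.sub_apply]
    rw [integral_sub hφi hui, smul_sub]
  simp only [h2, sub_zero] at h1
  have h3 : ∫⁻ x in K, ‖(φ - u) x‖ₑ ^ 2 ≤
      eLpNorm (fun x => φ x - u x) 2 (volume.restrict R.toSet) ^ 2 := by
    rw [eLpNorm_two_sq]
    exact lintegral_mono_set hK.subset
  rw [← ENNReal.pow_le_pow_left_iff two_ne_zero, mul_pow]
  have h4 := (ENNReal.le_div_iff_mul_le (Or.inl hV0) (Or.inl hVt)).2 (h1.trans h3)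
  refine h4.trans ?_
  rw [ENNReal.div_eq_inv_mul]
  gcongr
  calc (volume K)⁻¹ ≤ (volume K)⁻¹ ^ 2 + 2 * (volume K)⁻¹ + 1 := by
        rw [add_assoc, two_mul]
        exact le_add_left (le_add_right le_self_add)
    _ = ((volume K)⁻¹ + 1) ^ 2 := by ring

/-- The face estimate for traces. -/
lemma IsTrace.eLpNorm_sub_proj0_le {κ : ℝ} (hκ : 1 ≤ κ) (hR : ∀ i j, R.side i ≤ κ * R.side j)
    (hF : IsFace K F) (hK : IsCutFrom K R) (hu : IsH1 R.toSet u g) {γ : E3 → ℝ}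
    (hγ : IsTrace R.toSet F u g γ) :
    eLpNorm (fun x => γ x - proj0 K u) 2 (μHE[2].restrict F) ≤
      ENNReal.ofReal (141 * √κ * √(Metric.diam K)) * eLpNorm g 2 (volume.restrict R.toSet) := by
  obtain ⟨hγ2, φ, hφ, hφu, hφg, hφγ⟩ := hγ
  have hφ1 : ∀ k, ContDiff ℝ 1 (φ k) := fun k => (hφ k).of_le (by exact_mod_cast le_top)
  set B := ENNReal.ofReal (141 * √κ * √(Metric.diam K))
  set S := μHE[2] F ^ (1 / 2 : ℝ) with hS
  have hSt : S ≠ ⊤ := ENNReal.rpow_ne_top_of_nonneg (by norm_num) (hF.measure_lt_top hK).ne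
  set N := eLpNorm g 2 (volume.restrict R.toSet)
  set a := fun k => eLpNorm (fun x => φ k x - u x) 2 (volume.restrict R.toSet)
  set b := fun k => eLpNorm (fun x => gradient (φ k) x - g x) 2 (volume.restrict R.toSet)
  set e := fun k => eLpNorm (fun x => φ k x - γ x) 2 (μHE[2].restrict F)
  -- Split through `φ k` and its mean over `K`: every term tends to 0 except `B * N`, which carries
  -- the uniform constant.
  have hle : ∀ k, eLpNorm (fun x => γ x - proj0 K u) 2 (μHE[2].restrict F) ≤
      e k + (B * (b k + N) + ((volume K)⁻¹ + 1) * a k * S) := by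
    intro k
    have hc := (hφ1 k).continuous
    have m1 : AEStronglyMeasurable (fun x => φ k x - γ x) (μHE[2].restrict F) :=
      hc.aestronglyMeasurable.sub hγ2.aestronglyMeasurable
    have m2 : AEStronglyMeasurable (fun x => φ k x - proj0 K (φ k)) (μHE[2].restrict F) :=
      (hc.sub continuous_const).aestronglyMeasurable
    have heq : (fun x => γ x - proj0 K u) = (fun x => γ x - φ k x) +
        ((fun x => φ k x - proj0 K (φ k)) + fun _ => proj0 K (φ k) - proj0 K u) := by
      ext x
      simp
    have m1' : AEStronglyMeasurable (fun x => γ x - φ k x) (μHE[2].restrict F) :=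
      hγ2.aestronglyMeasurable.sub hc.aestronglyMeasurable
    have m3 : AEStronglyMeasurable (fun _ : E3 => proj0 K (φ k) - proj0 K u)
      (μHE[2].restrict F) := aestronglyMeasurable_const
    rw [heq]
    refine (eLpNorm_add_le m1' (m2.add m3) (by norm_num)).trans (add_le_add ?_ ?_)
    · exact (eLpNorm_sub_comm γ (φ k) 2 (μHE[2].restrict F)).le
    refine (eLpNorm_add_le m2 m3 (by norm_num)).trans (add_le_add ?_ ?_)
    · refine (hF.eLpNorm_sub_proj0_le hκ hR hK (hφ1 k)).trans (mul_le_mul' le_rfl ?_)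
      have m4 : AEStronglyMeasurable (fun x => gradient (φ k) x - g x)
          (volume.restrict R.toSet) :=
        (continuous_gradient (hφ1 k)).aestronglyMeasurable.sub hu.memLp_grad.aestronglyMeasurable
      have h := eLpNorm_add_le m4 hu.memLp_grad.aestronglyMeasurable (p := 2) (by norm_num)
      have h' : (fun x => gradient (φ k) x - g x) + g = gradient (φ k) := by ext1 x; simp
      rwa [h'] at h
    · rw [eLpNorm_const' _ two_ne_zero (by norm_num), Measure.restrict_apply_univ]
      exact mul_le_mul' (enorm_proj0_sub_proj0_le hK hc hu.memLp) (by simp [hS])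
  have hlim : Tendsto (fun k => e k + (B * (b k + N) + ((volume K)⁻¹ + 1) * a k * S)) atTop
      (𝓝 (0 + (B * (0 + N) + ((volume K)⁻¹ + 1) * 0 * S))) := by
    refine hφγ.add (.add ?_ ?_)
    · exact ENNReal.Tendsto.const_mul (hφg.add tendsto_const_nhds) (Or.inr ENNReal.ofReal_ne_top)
    · refine ENNReal.Tendsto.mul_const (ENNReal.Tendsto.const_mul hφu (Or.inr ?_)) (Or.inr hSt)
      exact ENNReal.add_ne_top.2 ⟨ENNReal.inv_ne_top.2 hK.volume_ne_zero, by simp⟩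
  simp only [mul_zero, zero_mul, add_zero, zero_add] at hlim
  exact ge_of_tendsto' hlim hle

end Trace

end CutCuboid

theorem lemma5p2 (κ : ℝ) (hκ : 1 ≤ κ) :
    ∃ C : ℝ, 0 < C ∧
      ∀ R : CutCuboid.Cuboid, (∀ i j, R.side i ≤ κ * R.side j) →
      ∀ K : Set CutCuboid.E3, CutCuboid.IsCutFrom K R →
      ∀ (u : CutCuboid.E3 → ℝ) (g : CutCuboid.E3 → CutCuboid.E3), CutCuboid.IsH1 R.toSet u g →
      ∀ F : Set CutCuboid.E3, CutCuboid.IsFace K F →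
        (∃ γ : CutCuboid.E3 → ℝ, CutCuboid.IsTrace R.toSet F u g γ) ∧
        ∀ γ : CutCuboid.E3 → ℝ, CutCuboid.IsTrace R.toSet F u g γ →
          eLpNorm (fun x => γ x - CutCuboid.proj0 K u) 2 (μHE[2].restrict F) ≤
            ENNReal.ofReal (C * Real.sqrt (Metric.diam K)) *
              eLpNorm g 2 (volume.restrict R.toSet) := by
  refine ⟨141 * √κ, mul_pos (by norm_num) (Real.sqrt_pos.2 (by linarith)), ?_⟩
  intro R hR K hK u g hu F hF
  exact ⟨hF.exists_trace hK hu, fun γ hγ => hγ.eLpNorm_sub_proj0_le hκ hR hF hK hu⟩
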